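/- Let $B$ be a Blaschke product on the unit disc $\mathbb D$, that is, $B(z)=\lambda z^m\prod_j \frac{|a_j|}{a_j}\frac{a_j-z}{1-\overline{a_j}z}$ with $|\lambda|=1$, $m\ge 0$, $0<|a_j|<1$ and $\sum_j(1-|a_j|)<\infty$ (finitely or infinitely many factors). Let $\sigma(B)$ be its spectrum, the set of points of the unit circle $\mathbb T$ near which $B$ has no analytic extension; the points of $\sigma(B)$ are called singular, the other points of $\mathbb T$ regular. Let $\mathcal G$ be the set of continuous maps $g:\mathbb T\to\mathbb T$ that map singular points to singular points and regular points to regular points, and satisfy $B(g(\zeta))=B(\zeta)$ for every regular $\zeta$, with composition as product. Suppose that $\sigma(B)$ consists of exactly $p$ points, where $p\ge 2$ is a prime number, and let $r$ be the number of those among the $p$ open arcs comprising $\mathbb T\setminus\sigma(B)$ that are of type 2, i.e. in which the solutions of $B(\zeta)=1$ accumulate precisely at both end points of the arc. Then $\mathcal G$ is a group, and 1. if $r=0$, then $\mathcal G$ is trivial or $\mathcal G\cong\mathbb Z_p$; 2. if $1\le r<p$, then $\mathcal G\cong\mathbb Z^r$; 3. if $r=p$, then $\mathcal G\cong\mathbb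 Z^p\rtimes\mathbb Z_p$, where $\mathbb Z_p$ acts by cyclic shifts of the coordinates; this group may be presented as $$\mathcal G\cong\langle x_1,\dots,x_p,y:\ y^p=e,\ x_jx_k=x_kx_j,\ yx_j=x_{j+1}y\ (\text{indices mod } p)\rangle.$$ In particular $\mathcal G$ is one of $\{e\}$, $\mathbb Z_p$, $\mathbb Z^r$ with $1\le r<p$, or $\mathbb Z^p\rtimes\mathbb Z_p$. -/

import Mathlib

open Filter Topology

namespace BlaschkeInvariants

/-- The factor `(|a| / a) (a - z) / (1 - conj a * z)` of a Blaschke product. -/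
noncomputable def blaschkeFactor (a z : ℂ) : ℂ :=
  ((‖a‖ : ℂ) / a) * ((a - z) / (1 - (starRingEnd ℂ) a * z))

/-- `B` is, on the open unit disc, a (finite or infinite) Blaschke product
`c z ^ m ∏ⱼ (|aⱼ| / aⱼ) (aⱼ - z) / (1 - conj aⱼ z)` with `|c| = 1`, `m ≥ 0`, `0 < |aⱼ| < 1` and
`∑ⱼ (1 - |aⱼ|) < ∞` (so that the index type `ι` is automatically countable).
The values of `B` off the open disc are irrelevant. -/
def IsBlaschkeProduct (B : ℂ → ℂ) : Prop :=
  ∃ (c : ℂ) (m : ℕ) (ι : Type) (a : ι → ℂ),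
    ‖c‖ = 1 ∧ (∀ j, 0 < ‖a j‖ ∧ ‖a j‖ < 1) ∧ Summable (fun j => 1 - ‖a j‖) ∧
    ∀ z ∈ Metric.ball (0 : ℂ) 1,
      ∃ w : ℂ, HasProd (fun j => blaschkeFactor (a j) z) w ∧ B z = c * z ^ m * w

/-- `ζ ∈ 𝕋` is a regular point of `B` if `B`, restricted to the open unit disc, has an analytic
extension into a neighbourhood of `ζ`. -/
def IsRegularPoint (B : ℂ → ℂ) (ζ : Circle) : Prop :=
  ∃ F : ℂ → ℂ, AnalyticAt ℂ F (ζ : ℂ) ∧ ∀ᶠ z in 𝓝[Metric.ball (0 : ℂ) 1] (ζ : ℂ), F z = B z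

/-- The spectrum `σ(B)`: the set of singular points of `B` on the unit circle. -/
def singularSet (B : ℂ → ℂ) : Set Circle := {ζ | ¬ IsRegularPoint B ζ}

/-- The boundary value of `B` at a point of the circle: the limit of `B` along the open unit disc.
It is used at regular points only, where the limit exists and is the value of the analytic
extension. -/
noncomputable def boundaryValue (B : ℂ → ℂ) (ζ : Circle) : ℂ :=
  extendFrom (Metric.ball (0 : ℂ) 1) B (ζ : ℂ)

theorem boundaryValue_eq {B F : ℂ → ℂ} {ζ : Circle} (hF : AnalyticAt ℂ F (ζ : ℂ))
    (h : ∀ᶠ z in 𝓝[Metric.ball (0 : ℂ) 1] (ζ : ℂ), F z = B z) :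
    boundaryValue B ζ = F ζ := by
  refine extendFrom_eq ?_ ?_
  · rw [closure_ball _ one_ne_zero]
    exact mem_closedBall_zero_iff.2 (Circle.norm_coe ζ).le
  · exact (hF.continuousAt.tendsto.mono_left nhdsWithin_le_nhds).congr' h

/-- The invariants of `B`: the continuous maps `g : 𝕋 → 𝕋` that send singular points to singular
points and regular points to regular points, with `B ∘ g = B` at the regular points. They are
given as a submonoid of the monoid of all self-maps of the circle under composition; that it
is a group is not built into the definition. -/
def invariants (B : ℂ → ℂ) : Submonoid (Function.End Circle) where
  carrier := {g : Circle → Circle | Continuous g ∧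
    (∀ ζ ∈ singularSet B, g ζ ∈ singularSet B) ∧
    (∀ ζ ∉ singularSet B, g ζ ∉ singularSet B ∧ boundaryValue B (g ζ) = boundaryValue B ζ)}
  one_mem' := ⟨continuous_id, fun _ h => h, fun _ h => ⟨h, rfl⟩⟩
  mul_mem' := by
    rintro g h ⟨hg, hg1, hg2⟩ ⟨hh, hh1, hh2⟩
    refine ⟨hg.comp hh, fun ζ hζ => hg1 _ (hh1 ζ hζ), fun ζ hζ => ?_⟩
    exact ⟨(hg2 _ (hh2 ζ hζ).1).1, ((hg2 _ (hh2 ζ hζ).1).2).trans (hh2 ζ hζ).2⟩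

/-- The open arc `(e^{iα}, e^{iβ})` is one of the intervals that make up `𝕋 \ σ(B)`. -/
def IsComplementaryArc (B : ℂ → ℂ) (α β : ℝ) : Prop :=
  α < β ∧ Circle.exp α ∈ singularSet B ∧ Circle.exp β ∈ singularSet B ∧
    ∀ θ ∈ Set.Ioo α β, Circle.exp θ ∉ singularSet B

/-- The interval `(e^{iα}, e^{iβ})` is of type 2: the solutions of `B = 1` in it accumulate
precisely at both of its ends (so there are infinitely many). Accumulation is taken in the angle,
which keeps the two ends apart. -/
def IsTypeTwo (B : ℂ → ℂ) (α β : ℝ) : Prop :=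
  {t : ℝ | AccPt t (𝓟 {θ | θ ∈ Set.Ioo α β ∧ boundaryValue B (Circle.exp θ) = 1})} = {α, β}

/-- The number of intervals of type 2 among those that make up `𝕋 \ σ(B)`; they are counted as
subsets of the circle. -/
noncomputable def numTypeTwo (B : ℂ → ℂ) : ℕ :=
  {I : Set Circle | ∃ α β : ℝ,
    IsComplementaryArc B α β ∧ IsTypeTwo B α β ∧ I = Circle.exp '' Set.Ioo α β}.ncard

/-- The action of `ℤ_n` on `ℤ^n` (written multiplicatively, coordinates indexed by `ℤ_n`) by
cyclic shifts: `k` sends the `j`-th unit vector to the `(j + k)`-th. -/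
def cyclicShift (n : ℕ) :
    Multiplicative (ZMod n) →* MulAut (Multiplicative (ZMod n → ℤ)) where
  toFun k :=
    { toFun := fun v => Multiplicative.ofAdd fun j => v.toAdd (j - k.toAdd)
      invFun := fun v => Multiplicative.ofAdd fun j => v.toAdd (j + k.toAdd)
      left_inv := fun v => by
        apply Multiplicative.toAdd.injective
        funext j
        simp
      right_inv := fun v => by
        apply Multiplicative.toAdd.injective
        funext j
        simp
      map_mul' := fun _ _ => rfl }
  map_one' := by
    refine MulEquiv.ext fun v => Multiplicative.toAdd.injective (funext fun j => ?_)
    change v.toAdd (j - 0) = v.toAdd j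
    rw [sub_zero]
  map_mul' k l := by
    refine MulEquiv.ext fun v => Multiplicative.toAdd.injective (funext fun j => ?_)
    change v.toAdd (j - (k.toAdd + l.toAdd)) = v.toAdd (j - k.toAdd - l.toAdd)
    rw [sub_sub]

/-- Generators `x_j`, with `j` taken modulo `n`, and `y`. -/
inductive Gen (n : ℕ) : Type
  | x (j : ZMod n) : Gen n
  | y : Gen n

/-- The relators of `y ^ n = e`, `x_j x_k = x_k x_j` and `y x_j = x_{j+1} y`. -/
inductive Relators (n : ℕ) : FreeGroup (Gen n) → Prop
  | order : Relators n (FreeGroup.of Gen.y ^ n)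
  | comm (j k : ZMod n) : Relators n
      ((FreeGroup.of (Gen.x j) * FreeGroup.of (Gen.x k)) *
        (FreeGroup.of (Gen.x k) * FreeGroup.of (Gen.x j))⁻¹)
  | shift (j : ZMod n) : Relators n
      ((FreeGroup.of Gen.y * FreeGroup.of (Gen.x j)) *
        (FreeGroup.of (Gen.x (j + 1)) * FreeGroup.of Gen.y)⁻¹)

/-- The group
`⟨x_1, …, x_n, y : y ^ n = e, x_j x_k = x_k x_j, y x_j = x_{j+1} y (indices mod n)⟩`. -/
abbrev ShiftPresentation (n : ℕ) : Type := PresentedGroup {w | Relators n w}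

end BlaschkeInvariants

namespace BlaschkeInvariants

open scoped ComplexConjugate

/-! On the regular part of the circle `B` is unimodular and its argument increases strictly.
Unimodularity holds because the zeros stay away from a regular point, which forces `|B(rζ)| → 1`
(`BlaschkeData.norm_extension`). The increase holds because `|B|` is at most the modulus of a single
factor, so the radial derivative is positive, and by analyticity the angular one is `i` times the
radial one (`IsBlaschkeProduct.boundary`). Hence `B = exp(iφ)` on the `j`-th arc, with `φ` a
homeomorphism onto an interval `R_j`, the `phaseRange`.

An invariant lifts to a continuous map of the line. It carries arcs into arcs, and on each arc it
changes `φ` by a constant in `2πℤ`. So it is increasing and sends ends to ends, and continuity at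
the singular points makes it rotate all the arcs by one residue `m` (`exists_isShift`). Conversely,
a pair `(v, m)` with `R_{j+m} = R_j + 2π v(j+m)` for all `j` is realized by solving for the phase on
each arc (`exists_invariant`). Thus the invariants are exactly the compatible pairs inside `ℤ^p ⋊
ℤ_p` (`exists_hom`).

An arc is of type 2 exactly when `R_j` is the whole line (`isTypeTwo_iff`). Any other `R_j` has no
non-zero translation symmetry, so `v` is rigid there. Rotations preserve the set `T` of type 2 arcs.
Since `p` is prime, a non-zero `m` forces `T` to be empty or everything, and the three cases follow.
-/

theorem one_sub_sum_le_prod_one_sub {ι : Type*} (s : Finset ι) (x : ι → ℝ)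
    (h0 : ∀ i, 0 ≤ x i) (h1 : ∀ i, x i ≤ 1) : 1 - ∑ i ∈ s, x i ≤ ∏ i ∈ s, (1 - x i) := by
  classical
  induction s using Finset.induction_on with
  | empty => simp
  | insert i s hi ih =>
    rw [Finset.sum_insert hi, Finset.prod_insert hi]
    have hs : 0 ≤ ∑ i ∈ s, x i := Finset.sum_nonneg fun i _ => h0 i
    nlinarith [h0 i, h1 i, mul_le_mul_of_nonneg_left ih (sub_nonneg.2 (h1 i)), mul_nonneg (h0 i) hs]

/-! ### Estimates for a single Blaschke factor -/

section Factor

variable {a z : ℂ}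

theorem one_sub_conj_mul_ne_zero (ha : ‖a‖ < 1) (hz : ‖z‖ < 1) : 1 - conj a * z ≠ 0 := by
  intro h
  have h1 : conj a * z = 1 := (sub_eq_zero.1 h).symm
  have h2 : ‖a‖ * ‖z‖ = 1 := by
    rw [← RCLike.norm_conj a, ← norm_mul, h1, norm_one]
  nlinarith [norm_nonneg a, norm_nonneg z]

/-- The correction term vanishes for `‖z‖ = 1` and is positive inside the disc when `‖a‖ < 1`. Both
the unimodularity and the monotonicity on the circle are read off from it. -/
theorem norm_sub_sq_eq (a z : ℂ) :
    ‖a - z‖ ^ 2 = ‖1 - conj a * z‖ ^ 2 - (1 - ‖a‖ ^ 2) * (1 - ‖z‖ ^ 2) := by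
  simp only [← Complex.normSq_eq_norm_sq, Complex.normSq_apply, Complex.sub_re, Complex.sub_im,
    Complex.mul_re, Complex.mul_im, Complex.conj_re, Complex.conj_im, Complex.one_re,
    Complex.one_im]
  ring

theorem norm_sq_blaschkeFactor (ha0 : 0 < ‖a‖) (ha : ‖a‖ < 1) (hz : ‖z‖ < 1) :
    ‖blaschkeFactor a z‖ ^ 2 =
      1 - (1 - ‖a‖ ^ 2) * (1 - ‖z‖ ^ 2) / ‖1 - conj a * z‖ ^ 2 := by
  have h := norm_pos_iff.2 (one_sub_conj_mul_ne_zero ha hz)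
  rw [blaschkeFactor, norm_mul, norm_div, norm_div, Complex.norm_real, norm_norm,
    div_self ha0.ne', one_mul, div_pow, norm_sub_sq_eq]
  field_simp

theorem norm_blaschkeFactor_le_one (ha0 : 0 < ‖a‖) (ha : ‖a‖ < 1) (hz : ‖z‖ < 1) :
    ‖blaschkeFactor a z‖ ≤ 1 := by
  have h := norm_sq_blaschkeFactor ha0 ha hz
  have h2 : 0 ≤ (1 - ‖a‖ ^ 2) * (1 - ‖z‖ ^ 2) / ‖1 - conj a * z‖ ^ 2 := by
    apply div_nonneg (mul_nonneg _ _) (by positivity) <;> nlinarith [norm_nonneg a, norm_nonneg z]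
  nlinarith [norm_nonneg (blaschkeFactor a z)]

theorem norm_blaschkeFactor_sub_one_le (ha0 : 0 < ‖a‖) (ha : ‖a‖ < 1) (hz : ‖z‖ < 1) :
    ‖blaschkeFactor a z - 1‖ ≤ 2 / (1 - ‖z‖) * (1 - ‖a‖) := by
  have h := one_sub_conj_mul_ne_zero ha hz
  have ha' : a ≠ 0 := norm_pos_iff.1 ha0
  have e : blaschkeFactor a z - 1 = -((1 - (‖a‖ : ℂ)) * ((a + ‖a‖ * z) / a)) / (1 - conj a * z) := by
    have hc : a * conj a = (‖a‖ : ℂ) ^ 2 := by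
      rw [Complex.mul_conj, Complex.normSq_eq_norm_sq]; push_cast; rfl
    have h' : 1 - z * conj a ≠ 0 := by rwa [mul_comm]
    rw [blaschkeFactor]
    field_simp
    linear_combination (z : ℂ) * hc
  have h1 : ‖(1 - (‖a‖ : ℂ))‖ = 1 - ‖a‖ := by
    rw [← Complex.ofReal_one, ← Complex.ofReal_sub, Complex.norm_real, Real.norm_eq_abs,
      abs_of_pos (by linarith)]
  have h2 : ‖(a + ‖a‖ * z) / a‖ ≤ 2 := by
    rw [norm_div, div_le_iff₀ ha0]
    calc _ ≤ ‖a‖ + ‖(‖a‖ : ℂ) * z‖ := norm_add_le _ _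
      _ = ‖a‖ + ‖a‖ * ‖z‖ := by rw [norm_mul, Complex.norm_real, norm_norm]
      _ ≤ _ := by nlinarith
  have h3 : 1 - ‖z‖ ≤ ‖1 - conj a * z‖ := by
    have := norm_sub_norm_le (1 : ℂ) (conj a * z)
    rw [norm_mul, RCLike.norm_conj, norm_one] at this
    nlinarith [norm_nonneg z]
  rw [e, norm_div, norm_neg, norm_mul, h1, div_mul_eq_mul_div]
  apply div_le_div₀ _ _ (by linarith) h3
  · nlinarith
  · nlinarith [norm_nonneg ((a + ‖a‖ * z) / a)]

theorem blaschkeFactor_self : blaschkeFactor a a = 0 := by simp [blaschkeFactor]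

theorem blaschkeFactor_ne_zero (ha0 : 0 < ‖a‖) (ha : ‖a‖ < 1) (hz : ‖z‖ < 1) (h : z ≠ a) :
    blaschkeFactor a z ≠ 0 :=
  mul_ne_zero (div_ne_zero (by simpa using norm_pos_iff.1 ha0) (norm_pos_iff.1 ha0))
    (div_ne_zero (sub_ne_zero.2 h.symm) (one_sub_conj_mul_ne_zero ha hz))

end Factor

/-! ### Zeros, boundary modulus and radial derivative of the product -/

section Product

variable {B : ℂ → ℂ} {c : ℂ} {m : ℕ} {ι : Type} {a : ι → ℂ}

/-- The data that exhibit `B` as a Blaschke product. -/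
structure BlaschkeData (B : ℂ → ℂ) (c : ℂ) (m : ℕ) {ι : Type} (a : ι → ℂ) : Prop where
  norm_const : ‖c‖ = 1
  zeros : ∀ j, 0 < ‖a j‖ ∧ ‖a j‖ < 1
  summable : Summable fun j => 1 - ‖a j‖
  prod : ∀ z ∈ Metric.ball (0 : ℂ) 1,
    ∃ w : ℂ, HasProd (fun j => blaschkeFactor (a j) z) w ∧ B z = c * z ^ m * w

/-- `HasProd` alone allows the limit zero. Here the terms `factor - 1` are absolutely summable, so
the product of non-zero factors cannot vanish. -/
theorem BlaschkeData.ne_zero (D : BlaschkeData B c m a) {z : ℂ} (hz : ‖z‖ < 1) (h0 : z ≠ 0)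
    (hza : ∀ j, z ≠ a j) : B z ≠ 0 := by
  obtain ⟨w, hw, hB⟩ := D.prod z (by simpa using hz)
  have hs : Summable fun j => ‖blaschkeFactor (a j) z - 1‖ :=
    Summable.of_nonneg_of_le (fun _ => norm_nonneg _)
      (fun j => norm_blaschkeFactor_sub_one_le (D.zeros j).1 (D.zeros j).2 hz)
      (D.summable.mul_left _)
  have hne := tprod_one_add_ne_zero_of_summable (f := fun j => blaschkeFactor (a j) z - 1)
    (fun j => by
      simpa using blaschkeFactor_ne_zero (D.zeros j).1 (D.zeros j).2 hz (hza j)) hs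
  simp only [add_sub_cancel] at hne
  rw [hw.tprod_eq] at hne
  rw [hB]
  exact mul_ne_zero (mul_ne_zero (norm_ne_zero_iff.1 (by simp [D.norm_const])) (pow_ne_zero _ h0))
    hne

theorem BlaschkeData.apply_zero (D : BlaschkeData B c m a) (j : ι) : B (a j) = 0 := by
  obtain ⟨w, hw, hB⟩ := D.prod (a j) (by simpa using (D.zeros j).2)
  have : w = 0 := hw.unique (hasProd_zero_of_exists_eq_zero ⟨j, blaschkeFactor_self⟩)
  rw [hB, this, mul_zero]

theorem BlaschkeData.countable (D : BlaschkeData B c m a) : Countable ι := by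
  have h := D.summable.countable_support
  have : Function.support (fun j => 1 - ‖a j‖) = Set.univ := by
    ext j
    simpa using (sub_pos.2 (D.zeros j).2).ne'
  rw [this] at h
  exact Set.countable_univ_iff.1 h

theorem BlaschkeData.norm_le (D : BlaschkeData B c m a) {z : ℂ} (hz : ‖z‖ < 1) (j : ι) :
    ‖B z‖ ≤ ‖blaschkeFactor (a j) z‖ := by
  classical
  obtain ⟨w, hw, hB⟩ := D.prod z (by simpa using hz)
  have h1 : ‖w‖ ≤ ‖blaschkeFactor (a j) z‖ := by
    refine le_of_tendsto (Tendsto.norm hw) ?_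
    filter_upwards [eventually_ge_atTop {j}] with s hs
    rw [← Finset.mul_prod_erase s _ (Finset.singleton_subset_iff.1 hs), norm_mul, norm_prod]
    refine mul_le_of_le_one_right (norm_nonneg _) (Finset.prod_le_one (fun _ _ => norm_nonneg _) ?_)
    exact fun i _ => norm_blaschkeFactor_le_one (D.zeros i).1 (D.zeros i).2 hz
  rw [hB, norm_mul, norm_mul, D.norm_const, one_mul, norm_pow]
  exact (mul_le_of_le_one_left (norm_nonneg _) (pow_le_one₀ (norm_nonneg _) hz.le)).trans h1

/-- The zeros of a Blaschke product stay away from its regular points. -/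
theorem BlaschkeData.exists_le_norm_sub (D : BlaschkeData B c m a) {ζ : Circle}
    (hζ : IsRegularPoint B ζ) : ∃ δ > 0, ∀ j, δ ≤ ‖a j - ζ‖ := by
  obtain ⟨F, hF, hFB⟩ := hζ
  rw [eventually_nhdsWithin_iff] at hFB
  -- Were the extension to vanish identically near `ζ`, so would `B` on a non-empty open part of the
  -- disc, although its zeros are countable. Hence a zero of the extension at `ζ` would be isolated.
  rcases hF.eventually_eq_zero_or_eventually_ne_zero with h | h
  · exfalso
    obtain ⟨ε, hε, hball⟩ := Metric.eventually_nhds_iff_ball.1 (h.and hFB)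
    have := D.countable
    have hd : Dense (insert 0 (Set.range a))ᶜ :=
      Set.Countable.dense_compl ℂ ((Set.countable_range a).insert 0)
    have hne : (Metric.ball (ζ : ℂ) ε ∩ Metric.ball 0 1).Nonempty := by
      have : (ζ : ℂ) ∈ closure (Metric.ball (0 : ℂ) 1) := by
        rw [closure_ball _ one_ne_zero]
        exact mem_closedBall_zero_iff.2 (Circle.norm_coe ζ).le
      exact mem_closure_iff.1 this _ Metric.isOpen_ball (Metric.mem_ball_self hε)
    obtain ⟨z, ⟨hz1, hz2⟩, hz3⟩ :=
      hd.inter_open_nonempty _ (Metric.isOpen_ball.inter Metric.isOpen_ball) hne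
    have hz := hball z hz1
    simp only [Set.mem_compl_iff, Set.mem_insert_iff, Set.mem_range, not_or, not_exists] at hz3
    exact D.ne_zero (by simpa using hz2) hz3.1 (fun j => (Ne.symm (hz3.2 j)))
      ((hz.2 hz2).symm.trans hz.1)
  · rw [eventually_nhdsWithin_iff] at h
    obtain ⟨ε, hε, hball⟩ := Metric.eventually_nhds_iff_ball.1 (h.and hFB)
    refine ⟨ε, hε, fun j => ?_⟩
    by_contra! hj
    have hz := hball (a j) (by simpa [dist_eq_norm] using hj)
    have hne : a j ≠ ζ := fun h => by
      have := (D.zeros j).2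
      rw [h, Circle.norm_coe] at this
      exact lt_irrefl _ this
    exact hz.1 hne ((hz.2 (by simpa using (D.zeros j).2)).trans (D.apply_zero j))

theorem norm_one_sub_conj_mul_circle (a : ℂ) (ζ : Circle) : ‖1 - conj a * ζ‖ = ‖a - ζ‖ := by
  have h := norm_sub_sq_eq a ζ
  rw [Circle.norm_coe] at h
  have h2 : ‖a - ζ‖ ^ 2 = ‖1 - conj a * ζ‖ ^ 2 := by linarith
  exact ((sq_eq_sq₀ (norm_nonneg _) (norm_nonneg _)).1 h2).symm

theorem norm_ofReal_mul_circle {r : ℝ} (hr : 0 ≤ r) (ζ : Circle) : ‖(r : ℂ) * ζ‖ = r := by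
  rw [norm_mul, Circle.norm_coe, mul_one, Complex.norm_real, Real.norm_of_nonneg hr]

/-- As the zeros keep a distance `δ` from `ζ`, each factor has squared modulus `1 - x j` on the
radius, with `x j` of order `(1 - r ^ 2) * (1 - ‖a j‖)`. The Weierstrass product inequality turns
this into a bound by the convergent sum. -/
theorem BlaschkeData.exists_le_norm_sq (D : BlaschkeData B c m a) {ζ : Circle}
    (hζ : IsRegularPoint B ζ) :
    ∃ K : ℝ, ∀ᶠ r : ℝ in 𝓝[<] (1 : ℝ), r ^ (2 * m) * (1 - (1 - r ^ 2) * K) ≤ ‖B (r * ζ)‖ ^ 2 := by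
  obtain ⟨δ, hδ, hδa⟩ := D.exists_le_norm_sub hζ
  -- The 8 is `2 * 4`: `1 - ‖a j‖ ^ 2 ≤ 2 * (1 - ‖a j‖)`, and for `r > 1 - δ / 2` the denominators
  -- are at least `(δ / 2) ^ 2`.
  refine ⟨8 / δ ^ 2 * ∑' j, (1 - ‖a j‖), ?_⟩
  have hr0 : ∀ᶠ r in 𝓝[<] (1 : ℝ), max 0 (1 - δ / 2) < r :=
    nhdsWithin_le_nhds (eventually_gt_nhds (by simp [hδ]))
  filter_upwards [hr0, self_mem_nhdsWithin] with r hr (hr1 : r < 1)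
  obtain ⟨hr0, hrδ⟩ := max_lt_iff.1 hr
  have hz : ‖(r : ℂ) * ζ‖ = r := norm_ofReal_mul_circle hr0.le ζ
  obtain ⟨w, hw, hB⟩ := D.prod (r * ζ) (by rwa [mem_ball_zero_iff, hz])
  have hr2 : 0 ≤ 1 - r ^ 2 := by nlinarith
  set x : ι → ℝ := fun j => (1 - ‖a j‖ ^ 2) * (1 - r ^ 2) / ‖1 - conj (a j) * (r * ζ)‖ ^ 2 with hx
  have hfac : ∀ j, ‖blaschkeFactor (a j) (r * ζ)‖ ^ 2 = 1 - x j := fun j => by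
    have := norm_sq_blaschkeFactor (D.zeros j).1 (D.zeros j).2 (z := r * ζ) (by rw [hz]; exact hr1)
    rwa [hz] at this
  have hx0 : ∀ j, 0 ≤ x j := fun j => by
    have := D.zeros j
    exact div_nonneg (mul_nonneg (by nlinarith) hr2) (by positivity)
  have hx1 : ∀ j, x j ≤ 1 := fun j => by
    have := sq_nonneg ‖blaschkeFactor (a j) (r * ζ)‖
    rw [hfac] at this
    linarith
  have hD : ∀ j, δ / 2 ≤ ‖1 - conj (a j) * (r * ζ)‖ := fun j => by
    have h1 : ‖1 - conj (a j) * ζ‖ - ‖conj (a j) * ((1 - r : ℝ) * ζ)‖ ≤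
        ‖1 - conj (a j) * (r * ζ)‖ := by
      have e : 1 - conj (a j) * (r * ζ) =
          (1 - conj (a j) * ζ) + conj (a j) * ((1 - r : ℝ) * ζ) := by push_cast; ring
      rw [e]
      have := norm_sub_norm_le (1 - conj (a j) * ζ) (-(conj (a j) * ((1 - r : ℝ) * ζ)))
      rwa [norm_neg, sub_neg_eq_add] at this
    rw [norm_one_sub_conj_mul_circle, norm_mul, RCLike.norm_conj,
      norm_ofReal_mul_circle (by linarith)] at h1
    nlinarith [hδa j, D.zeros j]
  have hxle : ∀ j, x j ≤ (1 - r ^ 2) * (8 / δ ^ 2) * (1 - ‖a j‖) := fun j => by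
    have h2 : (δ / 2) ^ 2 ≤ ‖1 - conj (a j) * (r * ζ)‖ ^ 2 := by
      have := hD j
      gcongr
    have := D.zeros j
    calc x j ≤ (2 * (1 - ‖a j‖)) * (1 - r ^ 2) / (δ / 2) ^ 2 := by
          apply div_le_div₀ _ _ (by positivity) h2
          · exact mul_nonneg (by linarith) hr2
          · exact mul_le_mul_of_nonneg_right (by nlinarith) hr2
      _ = _ := by field_simp; ring
  have hlim : 1 - (1 - r ^ 2) * (8 / δ ^ 2 * ∑' j, (1 - ‖a j‖)) ≤ ‖w‖ ^ 2 := by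
    refine ge_of_tendsto ((Tendsto.norm hw).pow 2) (Eventually.of_forall fun s => ?_)
    rw [norm_prod, ← Finset.prod_pow, Finset.prod_congr rfl fun j _ => hfac j]
    refine le_trans ?_ (one_sub_sum_le_prod_one_sub s x hx0 hx1)
    have h1 : ∑ j ∈ s, x j ≤ (1 - r ^ 2) * (8 / δ ^ 2) * ∑ j ∈ s, (1 - ‖a j‖) := by
      rw [Finset.mul_sum]
      exact Finset.sum_le_sum fun j _ => hxle j
    have h2 : ∑ j ∈ s, (1 - ‖a j‖) ≤ ∑' j, (1 - ‖a j‖) :=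
      D.summable.sum_le_tsum s fun j _ => (sub_pos.2 (D.zeros j).2).le
    have h3 := mul_le_mul_of_nonneg_left h2 (mul_nonneg hr2 (by positivity : 0 ≤ 8 / δ ^ 2))
    linarith
  rw [hB, norm_mul, norm_mul, D.norm_const, one_mul, norm_pow, hz, mul_pow, ← pow_mul,
    mul_comm m 2]
  exact mul_le_mul_of_nonneg_left hlim (by positivity)

/-- Without factors `B` is `c * z ^ m`, which extends analytically everywhere. The factor so
obtained provides the upper bounds for `‖B‖`. -/
theorem BlaschkeData.nonempty_index (D : BlaschkeData B c m a) (h : (singularSet B).Nonempty) :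
    Nonempty ι := by
  by_contra hι
  rw [not_nonempty_iff] at hι
  obtain ⟨ζ, hζ⟩ := h
  refine hζ ⟨fun z => c * z ^ m, by fun_prop, ?_⟩
  filter_upwards [self_mem_nhdsWithin] with z hz
  obtain ⟨w, hw, hB⟩ := D.prod z hz
  rw [hB, hw.unique hasProd_empty, mul_one]

theorem tendsto_ofReal_mul_circle (ζ : Circle) :
    Tendsto (fun r : ℝ => (r : ℂ) * ζ) (𝓝[<] 1) (𝓝[Metric.ball (0 : ℂ) 1] (ζ : ℂ)) := by
  refine tendsto_nhdsWithin_iff.2 ⟨?_, ?_⟩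
  · have : Continuous fun r : ℝ => (r : ℂ) * ζ := by fun_prop
    simpa using (this.tendsto 1).mono_left nhdsWithin_le_nhds
  · have h0 : ∀ᶠ r in 𝓝[<] (1 : ℝ), 0 < r :=
      nhdsWithin_le_nhds (eventually_gt_nhds one_pos)
    filter_upwards [h0, self_mem_nhdsWithin] with r hr (hr1 : r < 1)
    rwa [mem_ball_zero_iff, norm_ofReal_mul_circle hr.le]

theorem BlaschkeData.norm_extension (D : BlaschkeData B c m a) (h : (singularSet B).Nonempty)
    {ζ : Circle} {F : ℂ → ℂ} (hF : AnalyticAt ℂ F ζ)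
    (hFB : ∀ᶠ z in 𝓝[Metric.ball (0 : ℂ) 1] (ζ : ℂ), F z = B z) : ‖F ζ‖ = 1 := by
  obtain ⟨j⟩ := D.nonempty_index h
  obtain ⟨K, hK⟩ := D.exists_le_norm_sq ⟨F, hF, hFB⟩
  have ht := tendsto_ofReal_mul_circle ζ
  have hlim : Tendsto (fun r : ℝ => ‖F (r * ζ)‖ ^ 2) (𝓝[<] 1) (𝓝 (‖F ζ‖ ^ 2)) :=
    ((hF.continuousAt.tendsto.comp (ht.mono_right nhdsWithin_le_nhds)).norm).pow 2
  have hlow : Tendsto (fun r : ℝ => r ^ (2 * m) * (1 - (1 - r ^ 2) * K)) (𝓝[<] 1) (𝓝 1) := by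
    have : Continuous fun r : ℝ => r ^ (2 * m) * (1 - (1 - r ^ 2) * K) := by fun_prop
    simpa using (this.tendsto 1).mono_left nhdsWithin_le_nhds
  have h1 : 1 ≤ ‖F ζ‖ ^ 2 := by
    refine le_of_tendsto_of_tendsto hlow hlim ?_
    filter_upwards [hK, ht.eventually hFB] with r hr hr'
    rwa [hr']
  have h2 : ‖F ζ‖ ^ 2 ≤ 1 := by
    refine le_of_tendsto hlim ?_
    filter_upwards [ht.eventually hFB, ht.eventually self_mem_nhdsWithin] with r hr' hr
    have hr : ‖(r : ℂ) * ζ‖ < 1 := by simpa using hr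
    rw [hr']
    exact pow_le_one₀ (norm_nonneg _) ((D.norm_le hr j).trans
      (norm_blaschkeFactor_le_one (D.zeros j).1 (D.zeros j).2 hr))
  nlinarith [norm_nonneg (F ζ)]

/-- The boundary derivative of a Blaschke product in the radial direction is positive. -/
theorem BlaschkeData.radial_deriv_pos (D : BlaschkeData B c m a) (h : (singularSet B).Nonempty)
    {ζ : Circle} {F : ℂ → ℂ} (hF : AnalyticAt ℂ F ζ)
    (hFB : ∀ᶠ z in 𝓝[Metric.ball (0 : ℂ) 1] (ζ : ℂ), F z = B z) :
    0 < inner ℝ (F ζ) (deriv F ζ * ζ) := by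
  obtain ⟨j⟩ := D.nonempty_index h
  have ht := tendsto_ofReal_mul_circle ζ
  have ha := D.zeros j
  -- From `‖1 - conj (a j) * z‖ ≤ 2` and `1 - r ≤ 1 - r ^ 2` one gets `‖B (r * ζ)‖ ^ 2 ≤ 1 - k * (1
  -- - r)`. So `‖F (r * ζ)‖ ^ 2 - k * r` has non-negative slopes from the left at `r = 1`.
  set k : ℝ := (1 - ‖a j‖ ^ 2) / 4 with hk
  have hk0 : 0 < k := by
    rw [hk]; apply div_pos _ (by norm_num); nlinarith
  have hpath : HasDerivAt (fun r : ℝ => F (r * ζ)) (deriv F ζ * ζ) 1 := by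
    have h1 : HasDerivAt (fun r : ℝ => (r : ℂ) * ζ) (ζ : ℂ) 1 := by
      simpa using (Complex.ofRealCLM.hasDerivAt (x := (1 : ℝ))).mul_const (ζ : ℂ)
    have h2 : HasDerivAt F (deriv F ζ) (((1 : ℝ) : ℂ) * ζ) := by
      simpa using hF.differentiableAt.hasDerivAt
    exact h2.comp (1 : ℝ) h1
  have hq : HasDerivAt (fun r : ℝ => ‖F (r * ζ)‖ ^ 2 - k * r)
      (2 * inner ℝ (F ζ) (deriv F ζ * ζ) - k) 1 := by
    have h := hpath.norm_sq.sub ((hasDerivAt_id (1 : ℝ)).const_mul k)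
    rwa [mul_one, Complex.ofReal_one, one_mul] at h
  have hs := (hasDerivAt_iff_tendsto_slope.1 hq).mono_left
    (nhdsWithin_mono 1 (s := Set.Iio 1) fun r (hr : r < 1) => hr.ne)
  have : 0 ≤ 2 * inner ℝ (F ζ) (deriv F ζ * ζ) - k := by
    refine ge_of_tendsto hs ?_
    have h0 : ∀ᶠ r in 𝓝[<] (1 : ℝ), 0 < r :=
      nhdsWithin_le_nhds (eventually_gt_nhds one_pos)
    filter_upwards [h0, self_mem_nhdsWithin, ht.eventually hFB] with r hr0 (hr : r < 1) hrB
    rw [slope_def_field]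
    refine div_nonneg_of_nonpos ?_ (by linarith)
    have hn := D.norm_extension h hF hFB
    have hz : ‖(r : ℂ) * ζ‖ = r := norm_ofReal_mul_circle hr0.le ζ
    have hz1 : ‖(r : ℂ) * ζ‖ < 1 := by rw [hz]; exact hr
    have hB := pow_le_pow_left₀ (norm_nonneg _) (D.norm_le hz1 j) 2
    rw [norm_sq_blaschkeFactor ha.1 ha.2 hz1, hz] at hB
    have hD : ‖1 - conj (a j) * (r * ζ)‖ ^ 2 ≤ 4 := by
      have h1 : ‖1 - conj (a j) * (r * ζ)‖ ≤ 2 := by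
        refine (norm_sub_le _ _).trans ?_
        rw [norm_mul, RCLike.norm_conj, hz, norm_one]
        nlinarith
      nlinarith [norm_nonneg (1 - conj (a j) * (r * ζ))]
    have hDpos : 0 < ‖1 - conj (a j) * (r * ζ)‖ ^ 2 :=
      pow_pos (norm_pos_iff.2 (one_sub_conj_mul_ne_zero ha.2 hz1)) 2
    have hx : k * (1 - r) ≤
        (1 - ‖a j‖ ^ 2) * (1 - r ^ 2) / ‖1 - conj (a j) * (r * ζ)‖ ^ 2 := by
      have hp : 0 ≤ 1 - ‖a j‖ ^ 2 := by nlinarith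
      calc k * (1 - r) = (1 - ‖a j‖ ^ 2) * (1 - r) / 4 := by rw [hk]; ring
        _ ≤ _ := by
          apply div_le_div₀ (mul_nonneg hp (by nlinarith)) _ hDpos hD
          exact mul_le_mul_of_nonneg_left (by nlinarith) hp
    simp only [Complex.ofReal_one, one_mul, hn, hrB]
    linarith
  linarith

end Product

/-! ### The increasing argument on an interval of regular points -/

theorem IsBlaschkeProduct.exists_data {B : ℂ → ℂ} (hB : IsBlaschkeProduct B) :
    ∃ (c : ℂ) (m : ℕ) (ι : Type) (a : ι → ℂ), BlaschkeData B c m a := by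
  obtain ⟨c, m, ι, a, h1, h2, h3, h4⟩ := hB
  exact ⟨c, m, ι, a, h1, h2, h3, h4⟩

/-- One `F` serves all nearby points of the circle, so boundary values can be differentiated through
it. -/
theorem eventually_extension {B F : ℂ → ℂ} {ζ : Circle} (hF : AnalyticAt ℂ F ζ)
    (hFB : ∀ᶠ z in 𝓝[Metric.ball (0 : ℂ) 1] (ζ : ℂ), F z = B z) :
    ∀ᶠ ξ : Circle in 𝓝 ζ, AnalyticAt ℂ F ξ ∧
      ∀ᶠ z in 𝓝[Metric.ball (0 : ℂ) 1] (ξ : ℂ), F z = B z := by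
  have hc : Tendsto (fun ξ : Circle => (ξ : ℂ)) (𝓝 ζ) (𝓝 (ζ : ℂ)) :=
    continuous_subtype_val.tendsto ζ
  refine (hc.eventually hF.eventually_analyticAt).and ?_
  rw [eventually_nhdsWithin_iff] at hFB
  filter_upwards [hc.eventually (eventually_eventually_nhds.2 hFB)] with ξ hξ
  exact eventually_nhdsWithin_iff.2 hξ

theorem hasDerivAt_coe_circle_exp (θ : ℝ) :
    HasDerivAt (fun t : ℝ => (Circle.exp t : ℂ)) (Complex.I * Circle.exp θ) θ := by
  have h : HasDerivAt (fun t : ℝ => Complex.exp (t * Complex.I))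
      (Complex.exp (θ * Complex.I) * Complex.I) θ := by
    have := ((Complex.ofRealCLM.hasDerivAt (x := θ)).mul_const Complex.I).cexp
    simpa using this
  simpa only [Circle.coe_exp, mul_comm Complex.I] using h

/-- The logarithmic derivative in the angle of the boundary values of a Blaschke product, divided
by `i`. -/
noncomputable def angularSpeed (B : ℂ → ℂ) (θ : ℝ) : ℝ :=
  (conj (boundaryValue B (Circle.exp θ)) *
    deriv (fun t => boundaryValue B (Circle.exp t)) θ).im

/-- Since `|F| = 1` along the circle, the tangential derivative is orthogonal to `F`, which makes
`conj F * F' * ζ` real. Its real part is the radial quantity already known to be positive, and it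
equals the angular speed. -/
theorem IsBlaschkeProduct.boundary {B : ℂ → ℂ} (hB : IsBlaschkeProduct B)
    (hσ : (singularSet B).Nonempty) {θ : ℝ} (hθ : Circle.exp θ ∉ singularSet B) :
    ‖boundaryValue B (Circle.exp θ)‖ = 1 ∧ 0 < angularSpeed B θ ∧
      ContinuousAt (angularSpeed B) θ ∧
      HasDerivAt (fun t => boundaryValue B (Circle.exp t))
        (Complex.I * angularSpeed B θ * boundaryValue B (Circle.exp θ)) θ := by
  obtain ⟨c, m, ι, a, D⟩ := hB.exists_data
  obtain ⟨F, hF, hFB⟩ := not_not.1 hθ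
  have hexp : Tendsto (fun t : ℝ => Circle.exp t) (𝓝 θ) (𝓝 (Circle.exp θ)) :=
    Circle.exp.continuous.tendsto θ
  have hev := hexp.eventually (eventually_extension hF hFB)
  have heq : (fun t => boundaryValue B (Circle.exp t)) =ᶠ[𝓝 θ] fun t => F (Circle.exp t) := by
    filter_upwards [hev] with t ht using boundaryValue_eq ht.1 ht.2
  have hder : ∀ᶠ t in 𝓝 θ, HasDerivAt (fun t : ℝ => F (Circle.exp t))
      (deriv F (Circle.exp t) * (Complex.I * Circle.exp t)) t := by
    filter_upwards [hev] with t ht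
    exact ht.1.differentiableAt.hasDerivAt.comp t (hasDerivAt_coe_circle_exp t)
  have hder0 := hder.self_of_nhds
  have hn := D.norm_extension hσ hF hFB
  have hval : boundaryValue B (Circle.exp θ) = F (Circle.exp θ) := heq.self_of_nhds
  have hspeed : angularSpeed B =ᶠ[𝓝 θ] fun t =>
      (conj (F (Circle.exp t)) * (deriv F (Circle.exp t) * (Complex.I * Circle.exp t))).im := by
    filter_upwards [heq.eventuallyEq_nhds, hder] with t ht ht'
    have h1 : boundaryValue B (Circle.exp t) = F (Circle.exp t) := ht.self_of_nhds
    rw [angularSpeed, ht.deriv_eq, h1, ht'.deriv]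
  have hpos := D.radial_deriv_pos hσ hF hFB
  have hrot : inner ℝ (F (Circle.exp θ))
      (deriv F (Circle.exp θ) * (Complex.I * Circle.exp θ)) = 0 := by
    have h1 := hder0.norm_sq
    have h2 : (fun t : ℝ => ‖F (Circle.exp t)‖ ^ 2) =ᶠ[𝓝 θ] fun _ => 1 := by
      filter_upwards [hev] with t ht
      rw [D.norm_extension hσ ht.1 ht.2, one_pow]
    have h3 := h1.unique ((hasDerivAt_const θ (1 : ℝ)).congr_of_eventuallyEq h2)
    linarith
  set w := F (Circle.exp θ) with hw
  set d := deriv F (Circle.exp θ) * Circle.exp θ with hd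
  have hd' : deriv F (Circle.exp θ) * (Complex.I * Circle.exp θ) = Complex.I * d := by
    rw [hd]; ring
  rw [hd'] at hrot hder0
  have hs0 : angularSpeed B θ = (conj w * d).re := by
    rw [hspeed.self_of_nhds]
    simp only [hd', ← hw, mul_left_comm _ Complex.I, Complex.I_mul_im]
  have hin : ∀ x y : ℂ, inner ℝ x y = (conj x * y).re := fun x y => by
    rw [Complex.inner, mul_comm]
  rw [hin] at hpos hrot
  have him : (conj w * d).im = 0 := by
    rw [mul_left_comm, Complex.I_mul_re] at hrot
    linarith
  have hreal : ((conj w * d).re : ℂ) = conj w * d := by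
    apply Complex.ext <;> simp only [Complex.ofReal_re, Complex.ofReal_im, him]
  refine ⟨by rw [hval, hn], by rw [hs0]; exact hpos, ?_, ?_⟩
  · refine ContinuousAt.congr ?_ hspeed.symm
    have hc : ContinuousAt (fun t : ℝ => (Circle.exp t : ℂ)) θ :=
      (hasDerivAt_coe_circle_exp θ).continuousAt
    have h1 : ContinuousAt (fun t : ℝ => F (Circle.exp t)) θ := hder0.continuousAt
    have h2 : ContinuousAt (fun t : ℝ => deriv F (Circle.exp t)) θ :=
      ContinuousAt.comp (f := fun t : ℝ => (Circle.exp t : ℂ)) hF.deriv.continuousAt hc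
    exact Complex.continuous_im.continuousAt.comp
      ((Complex.continuous_conj.continuousAt.comp h1).mul
        (h2.mul (continuousAt_const.mul hc)))
  · refine HasDerivAt.congr_of_eventuallyEq ?_ heq
    refine hder0.congr_deriv ?_
    rw [hs0, hreal, hval]
    have hww : conj w * w = 1 := by
      rw [mul_comm, Complex.mul_conj, Complex.normSq_eq_norm_sq, hn]; norm_num
    linear_combination (-Complex.I * d) * hww

/-- On an interval of regular points the boundary values have a strictly increasing continuous
argument. -/
theorem IsBlaschkeProduct.exists_phase {B : ℂ → ℂ} (hB : IsBlaschkeProduct B)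
    (hσ : (singularSet B).Nonempty) {α β : ℝ} (hαβ : α < β)
    (h : ∀ θ ∈ Set.Ioo α β, Circle.exp θ ∉ singularSet B) :
    ∃ φ : ℝ → ℝ, ContinuousOn φ (Set.Ioo α β) ∧ StrictMonoOn φ (Set.Ioo α β) ∧
      ∀ θ ∈ Set.Ioo α β, (Circle.exp (φ θ) : ℂ) = boundaryValue B (Circle.exp θ) := by
  obtain ⟨θ₀, hθ₀⟩ := Set.nonempty_Ioo.2 hαβ
  set f : ℝ → ℂ := fun t => boundaryValue B (Circle.exp t) with hf
  set L := angularSpeed B with hL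
  have hcont : ContinuousOn L (Set.Ioo α β) := fun θ hθ =>
    (hB.boundary hσ (h θ hθ)).2.2.1.continuousWithinAt
  set φ : ℝ → ℝ := fun θ => (f θ₀).arg + ∫ t in θ₀..θ, L t with hφ
  have hder : ∀ θ ∈ Set.Ioo α β, HasDerivAt φ (L θ) θ := fun θ hθ => by
    refine HasDerivAt.const_add _ (intervalIntegral.integral_hasDerivAt_right ?_ ?_ ?_)
    · refine (hcont.mono ?_).intervalIntegrable
      exact Set.ordConnected_Ioo.uIcc_subset hθ₀ hθ
    · exact hcont.stronglyMeasurableAtFilter isOpen_Ioo θ hθ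
    · exact (hB.boundary hσ (h θ hθ)).2.2.1
  have hcφ : ContinuousOn φ (Set.Ioo α β) := fun θ hθ => (hder θ hθ).continuousAt.continuousWithinAt
  refine ⟨φ, hcφ, ?_, ?_⟩
  · refine strictMonoOn_of_deriv_pos (convex_Ioo α β) hcφ fun θ hθ => ?_
    rw [interior_Ioo] at hθ
    rw [(hder θ hθ).deriv]
    exact (hB.boundary hσ (h θ hθ)).2.1
  -- `f` and `exp(iφ)` solve the same linear differential equation, so this quotient is constant;
  -- the starting value of `φ` makes it 1.
  · set q : ℝ → ℂ := fun θ => f θ * Complex.exp (-(φ θ * Complex.I)) with hq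
    have hqd : ∀ θ ∈ Set.Ioo α β, HasDerivAt q 0 θ := fun θ hθ => by
      have h1 := (hB.boundary hσ (h θ hθ)).2.2.2
      have h2 := ((hder θ hθ).ofReal_comp.mul_const Complex.I).neg.cexp
      refine (h1.mul h2).congr_deriv ?_
      ring
    have hconst : ∀ θ ∈ Set.Ioo α β, q θ = q θ₀ := fun θ hθ => by
      refine IsOpen.is_const_of_deriv_eq_zero isOpen_Ioo isPreconnected_Ioo
        (fun x hx => (hqd x hx).differentiableAt.differentiableWithinAt)
        (fun x hx => (hqd x hx).deriv) hθ hθ₀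
    have h0 : q θ₀ = 1 := by
      have hn := (hB.boundary hσ (h θ₀ hθ₀)).1
      have h1 : Complex.exp ((f θ₀).arg * Complex.I) = f θ₀ := by
        have := Complex.norm_mul_exp_arg_mul_I (f θ₀)
        rwa [show ‖f θ₀‖ = 1 from hn, Complex.ofReal_one, one_mul] at this
      simp only [hq, hφ, intervalIntegral.integral_same, add_zero]
      have h2 : f θ₀ ≠ 0 := norm_ne_zero_iff.1 (by rw [show ‖f θ₀‖ = 1 from hn]; exact one_ne_zero)
      rw [Complex.exp_neg, h1, mul_inv_cancel₀ h2]
    intro θ hθ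
    have := (hconst θ hθ).trans h0
    simp only [hq, Complex.exp_neg] at this
    rw [Circle.coe_exp]
    exact ((mul_inv_eq_one₀ (Complex.exp_ne_zero _)).1 this).symm

end BlaschkeInvariants

/-! ### Enumeration of the singular angles and a global phase -/

namespace BlaschkeInvariants

open scoped Real

/-- A strictly increasing bi-infinite sequence of angles that is invariant under the rotation by
`2π`, with `p` terms to the turn. -/
structure Cuts (p : ℕ) (s : ℤ → ℝ) : Prop where
  pos : 0 < p
  strictMono : StrictMono s
  period : ∀ i, s (i + p) = s i + 2 * π

/-- The index of the half-open interval `[s i, s (i + 1))` that contains an angle. -/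
noncomputable def cutIndex (s : ℤ → ℝ) (θ : ℝ) : ℤ :=
  Classical.epsilon fun i => s i ≤ θ ∧ θ < s (i + 1)

/-- The index modulo `p` of the arc that contains a point of the circle. -/
noncomputable def arcIndex (p : ℕ) (s : ℤ → ℝ) (ζ : Circle) : ZMod p :=
  (cutIndex s (ζ : ℂ).arg : ZMod p)

namespace Cuts

variable {p : ℕ} {s : ℤ → ℝ}

theorem period_mul (C : Cuts p s) (i n : ℤ) : s (i + n * p) = s i + n * (2 * π) := by
  induction n using Int.induction_on with
  | zero => simp
  | succ n ih =>
    have h := C.period (i + n * p)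
    rw [show i + ((n : ℤ) + 1) * p = i + n * p + p by ring, h, ih]
    push_cast; ring
  | pred n ih =>
    have h := C.period (i + (-(n : ℤ) - 1) * p)
    rw [show i + (-(n : ℤ) - 1) * p + p = i + -(n : ℤ) * p by ring, ih] at h
    push_cast at h ⊢; linarith

theorem cutIndex_spec (C : Cuts p s) (θ : ℝ) :
    s (cutIndex s θ) ≤ θ ∧ θ < s (cutIndex s θ + 1) := by
  have hπ : 0 < 2 * π := Real.two_pi_pos
  refine Classical.epsilon_spec (p := fun i => s i ≤ θ ∧ θ < s (i + 1)) ?_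
  obtain ⟨n, hn⟩ := exists_int_gt ((θ - s 0) / (2 * π))
  obtain ⟨k, hk⟩ := exists_int_lt ((θ - s 0) / (2 * π))
  have hn' : θ < s (0 + n * p) := by
    rw [C.period_mul]; rw [div_lt_iff₀ hπ] at hn; linarith
  have hk' : s (0 + k * p) ≤ θ := by
    rw [C.period_mul]; rw [lt_div_iff₀ hπ] at hk; linarith
  obtain ⟨i, hi, hmax⟩ := Int.exists_greatest_of_bdd (P := fun i => s i ≤ θ)
    ⟨_, fun z hz => (C.strictMono.lt_iff_lt.1 (hz.trans_lt hn')).le⟩ ⟨_, hk'⟩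
  refine ⟨i, hi, ?_⟩
  by_contra! h
  have := hmax _ h
  omega

theorem cutIndex_eq (C : Cuts p s) {θ : ℝ} {i : ℤ} (h1 : s i ≤ θ) (h2 : θ < s (i + 1)) :
    cutIndex s θ = i := by
  obtain ⟨h3, h4⟩ := C.cutIndex_spec θ
  have := C.strictMono.lt_iff_lt.1 (h1.trans_lt h4)
  have := C.strictMono.lt_iff_lt.1 (h3.trans_lt h2)
  omega

theorem cutIndex_of_mem (C : Cuts p s) {θ : ℝ} {i : ℤ} (h : θ ∈ Set.Ioo (s i) (s (i + 1))) :
    cutIndex s θ = i := C.cutIndex_eq h.1.le h.2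

theorem cutIndex_cut (C : Cuts p s) (i : ℤ) : cutIndex s (s i) = i :=
  C.cutIndex_eq le_rfl (C.strictMono (by omega))

theorem cutIndex_add (C : Cuts p s) (θ : ℝ) (n : ℤ) :
    cutIndex s (θ + n * (2 * π)) = cutIndex s θ + n * p := by
  obtain ⟨h3, h4⟩ := C.cutIndex_spec θ
  apply C.cutIndex_eq
  · rw [C.period_mul]; linarith
  · rw [add_right_comm, C.period_mul]; linarith

theorem mem_Ioo_cutIndex (C : Cuts p s) {θ : ℝ} (h : θ ∉ Set.range s) :
    θ ∈ Set.Ioo (s (cutIndex s θ)) (s (cutIndex s θ + 1)) := by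
  obtain ⟨h3, h4⟩ := C.cutIndex_spec θ
  exact ⟨lt_of_le_of_ne h3 fun e => h ⟨_, e⟩, h4⟩

theorem notMem_range (C : Cuts p s) {θ : ℝ} {i : ℤ} (h : θ ∈ Set.Ioo (s i) (s (i + 1))) :
    θ ∉ Set.range s := by
  rintro ⟨k, rfl⟩
  have := C.strictMono.lt_iff_lt.1 h.1
  have := C.strictMono.lt_iff_lt.1 h.2
  omega

theorem add_mem_Ioo (C : Cuts p s) {θ : ℝ} {i : ℤ} (n : ℤ) (h : θ ∈ Set.Ioo (s i) (s (i + 1))) :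
    θ + n * (2 * π) ∈ Set.Ioo (s (i + n * p)) (s (i + n * p + 1)) := by
  rw [add_right_comm, C.period_mul, C.period_mul]
  exact ⟨by linarith [h.1], by linarith [h.2]⟩

theorem arcIndex_exp (C : Cuts p s) (θ : ℝ) :
    arcIndex p s (Circle.exp θ) = (cutIndex s θ : ZMod p) := by
  obtain ⟨n, hn⟩ := Circle.exp_eq_exp.1 (Circle.exp_arg (Circle.exp θ))
  rw [arcIndex, hn, C.cutIndex_add]
  simp

end Cuts

/-- The angles of the points of a finite subset of the circle. -/
theorem exists_cuts {σ : Set Circle} {p : ℕ} (hp : 0 < p) (hσ : σ.ncard = p) :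
    ∃ s : ℤ → ℝ, Cuts p s ∧ ∀ θ, Circle.exp θ ∈ σ ↔ θ ∈ Set.range s := by
  have hπ : 0 < 2 * π := Real.two_pi_pos
  have hfin : σ.Finite := Set.finite_of_ncard_pos (by omega)
  set T : Set ℝ := {θ | θ ∈ Set.Ico 0 (2 * π) ∧ Circle.exp θ ∈ σ} with hT
  have hinj : Set.InjOn Circle.exp T := (Circle.exp_injOn_Ico (by simp)).mono fun θ h => h.1
  have hmod : ∀ θ : ℝ, toIcoMod hπ 0 θ ∈ Set.Ico 0 (2 * π) ∧
      θ = toIcoMod hπ 0 θ + toIcoDiv hπ 0 θ * (2 * π) := fun θ => by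
    refine ⟨by simpa using toIcoMod_mem_Ico hπ 0 θ, ?_⟩
    have := toIcoMod_add_toIcoDiv_zsmul hπ 0 θ
    rw [zsmul_eq_mul] at this
    exact this.symm
  have himg : Circle.exp '' T = σ := by
    ext ζ
    constructor
    · rintro ⟨θ, hθ, rfl⟩
      exact hθ.2
    · intro hζ
      obtain ⟨θ, rfl⟩ := Circle.exp_surjective ζ
      obtain ⟨h1, h2⟩ := hmod θ
      have h3 : Circle.exp θ = Circle.exp (toIcoMod hπ 0 θ) := Circle.exp_eq_exp.2 ⟨_, h2⟩
      exact ⟨_, ⟨h1, h3 ▸ hζ⟩, h3.symm⟩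
  have hTfin : T.Finite := Set.Finite.of_finite_image (himg ▸ hfin) hinj
  have hcard : hTfin.toFinset.card = p := by
    rw [← Set.ncard_eq_toFinset_card T hTfin, ← hσ, ← himg, hinj.ncard_image]
  set e := hTfin.toFinset.orderEmbOfFin hcard with he
  have heT : ∀ k, e k ∈ T := fun k => by
    have := Finset.orderEmbOfFin_mem hTfin.toFinset hcard k
    exact hTfin.mem_toFinset.1 this
  have hp' : (0 : ℤ) < p := by exact_mod_cast hp
  have hlt : ∀ i : ℤ, (i % p).toNat < p := fun i => by
    have := Int.emod_lt_of_pos i hp'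
    have := Int.emod_nonneg i hp'.ne'
    omega
  -- The remainder selects one of the `p` ordered angles in `[0, 2π)`, the quotient counts full
  -- turns.
  set s : ℤ → ℝ := fun i => e ⟨(i % p).toNat, hlt i⟩ + (i / p : ℤ) * (2 * π) with hs
  have hdiv : ∀ q r : ℤ, 0 ≤ r → ∀ h : r.toNat < p,
      s (r + q * p) = e ⟨r.toNat, h⟩ + q * (2 * π) := by
    intro q r h0 h
    have h1 : (r + q * p) % p = r := by
      rw [Int.add_mul_emod_self_right, Int.emod_eq_of_lt h0 (by omega)]
    have h2 : (r + q * p) / p = q := by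
      rw [Int.add_mul_ediv_right _ _ hp'.ne', Int.ediv_eq_zero_of_lt h0 (by omega), zero_add]
    simp only [hs, h1, h2]
  have hrep : ∀ i : ℤ, ∃ q r : ℤ, 0 ≤ r ∧ r < p ∧ i = r + q * p := fun i =>
    ⟨i / p, i % p, Int.emod_nonneg i hp'.ne', Int.emod_lt_of_pos i hp', by
      rw [mul_comm]; exact (Int.emod_add_mul_ediv i p).symm⟩
  refine ⟨s, ⟨hp, strictMono_int_of_lt_succ fun i => ?_, fun i => ?_⟩, fun θ => ⟨fun h => ?_, ?_⟩⟩
  · obtain ⟨q, r, h0, h1, rfl⟩ := hrep i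
    rw [hdiv q r h0 (by omega)]
    by_cases h2 : r + 1 < p
    · rw [add_right_comm, hdiv q (r + 1) (by omega) (by omega), add_lt_add_iff_right,
        e.lt_iff_lt, Fin.mk_lt_mk]
      omega
    · have : r + q * p + 1 = 0 + (q + 1) * p := by
        rw [add_mul, one_mul]; omega
      rw [this, hdiv (q + 1) 0 le_rfl (by simpa using hp)]
      have h3 := (heT ⟨r.toNat, by omega⟩).1.2
      have h4 : 0 ≤ e ⟨(0 : ℤ).toNat, by simpa using hp⟩ := (heT _).1.1
      rw [Int.cast_add, Int.cast_one]
      linarith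
  · obtain ⟨q, r, h0, h1, rfl⟩ := hrep i
    rw [hdiv q r h0 (by omega), show r + q * p + p = r + (q + 1) * p by ring,
      hdiv (q + 1) r h0 (by omega)]
    push_cast; ring
  · obtain ⟨h1, h2⟩ := hmod θ
    have h3 : Circle.exp θ = Circle.exp (toIcoMod hπ 0 θ) := Circle.exp_eq_exp.2 ⟨_, h2⟩
    have h4 : toIcoMod hπ 0 θ ∈ Set.range e := by
      rw [he, Finset.range_orderEmbOfFin]
      exact hTfin.mem_toFinset.2 ⟨h1, h3 ▸ h⟩
    obtain ⟨k, hk⟩ := h4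
    refine ⟨(k : ℤ) + toIcoDiv hπ 0 θ * p, ?_⟩
    rw [hdiv _ _ (by omega) (by omega), h2]
    simp [hk]
  · rintro ⟨i, rfl⟩
    have : Circle.exp (s i) = Circle.exp (e ⟨(i % p).toNat, hlt i⟩) :=
      Circle.exp_eq_exp.2 ⟨_, rfl⟩
    rw [this]
    exact (heT _).2

/-- The singular points of `B` are cut out by `s`, and on every one of the complementary arcs `φ`
is a continuous strictly increasing argument of the boundary values of `B`. -/
structure PhaseData (p : ℕ) (B : ℂ → ℂ) (s : ℤ → ℝ) (φ : Circle → ℝ) : Prop extends Cuts p s where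
  mem_singularSet : ∀ θ, Circle.exp θ ∈ singularSet B ↔ θ ∈ Set.range s
  continuousOn : ∀ i, ContinuousOn (fun θ => φ (Circle.exp θ)) (Set.Ioo (s i) (s (i + 1)))
  strictMonoOn : ∀ i, StrictMonoOn (fun θ => φ (Circle.exp θ)) (Set.Ioo (s i) (s (i + 1)))
  exp_phase : ∀ ζ ∉ singularSet B, (Circle.exp (φ ζ) : ℂ) = boundaryValue B ζ

theorem IsBlaschkeProduct.exists_phaseData {B : ℂ → ℂ} (hB : IsBlaschkeProduct B) {p : ℕ}
    (hp : 0 < p) (hσ : (singularSet B).ncard = p) :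
    ∃ (s : ℤ → ℝ) (φ : Circle → ℝ), PhaseData p B s φ := by
  obtain ⟨s, C, hs⟩ := exists_cuts hp hσ
  have hne : (singularSet B).Nonempty := Set.nonempty_of_ncard_ne_zero (by omega)
  have hreg : ∀ i, ∀ θ ∈ Set.Ioo (s i) (s (i + 1)), Circle.exp θ ∉ singularSet B :=
    fun i θ hθ h => C.notMem_range hθ ((hs θ).1 h)
  choose Φ hΦc hΦm hΦe using fun i => hB.exists_phase hne (C.strictMono (lt_add_one i)) (hreg i)
  have hp' : (p : ℤ) ≠ 0 := by exact_mod_cast hp.ne'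
  -- The `Φ i` were chosen independently, so `Φ i` and `Φ (i + p)` need not match under the rotation
  -- by `2π`. Only indices in `[0, p)` are used and transported to the other turns, which makes `φ`
  -- well defined on the circle. Its values at the cuts carry no information.
  set ψ : ℝ → ℝ := fun θ =>
    Φ (cutIndex s θ % p) (θ - (cutIndex s θ / p : ℤ) * (2 * π)) with hψ
  set φ : Circle → ℝ := fun ζ => ψ (ζ : ℂ).arg with hφ
  have hφexp : ∀ θ, φ (Circle.exp θ) = ψ θ := fun θ => by
    obtain ⟨n, hn⟩ := Circle.exp_eq_exp.1 (Circle.exp_arg (Circle.exp θ))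
    simp only [hφ, hn, hψ, C.cutIndex_add, Int.add_mul_emod_self_right,
      Int.add_mul_ediv_right _ _ hp']
    congr 1
    push_cast; ring
  have hmap : ∀ i, Set.MapsTo (fun θ => θ - (i / p : ℤ) * (2 * π)) (Set.Ioo (s i) (s (i + 1)))
      (Set.Ioo (s (i % p)) (s (i % p + 1))) := fun i θ hθ => by
    have h := C.add_mem_Ioo (-(i / p)) hθ
    have e : i + -(i / p) * p = i % p := by
      have := Int.emod_add_mul_ediv i p
      linarith [mul_comm (i / p) (p : ℤ)]
    rw [e] at h
    push_cast at h
    simpa [sub_eq_add_neg] using h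
  have hon : ∀ i, Set.EqOn (fun θ => φ (Circle.exp θ))
      (fun θ => Φ (i % p) (θ - (i / p : ℤ) * (2 * π))) (Set.Ioo (s i) (s (i + 1))) :=
    fun i θ hθ => by simp only [hφexp, hψ, C.cutIndex_of_mem hθ]
  refine ⟨s, φ, C, hs, fun i => ?_, fun i => ?_, fun ζ hζ => ?_⟩
  · exact ((hΦc _).comp (by fun_prop) (hmap i)).congr (hon i)
  · refine StrictMonoOn.congr (fun x hx y hy hxy => ?_) (hon i).symm
    exact hΦm _ (hmap i hx) (hmap i hy) (by simpa using hxy)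
  · obtain ⟨θ, rfl⟩ := Circle.exp_surjective ζ
    have hθ := C.mem_Ioo_cutIndex fun h => hζ ((hs θ).2 h)
    have := hon _ hθ
    simp only at this
    rw [this, hΦe _ _ (hmap _ hθ)]
    congr 1
    exact Circle.exp_eq_exp.2 ⟨-(cutIndex s θ / p), by push_cast; ring⟩

end BlaschkeInvariants

/-! ### Invariants as rotations of the arcs combined with shifts of the phase -/

namespace BlaschkeInvariants

open scoped Real

/-- The values of the phase `φ` on the `j`-th arc. -/
def phaseRange (p : ℕ) (B : ℂ → ℂ) (s : ℤ → ℝ) (φ : Circle → ℝ) (j : ZMod p) : Set ℝ :=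
  φ '' {ζ | ζ ∉ singularSet B ∧ arcIndex p s ζ = j}

/-- `g` rotates the arcs by `m` and adds `2π v j` to the phase on the way into the `j`-th arc. -/
def IsShift (p : ℕ) (B : ℂ → ℂ) (s : ℤ → ℝ) (φ : Circle → ℝ) (g : Circle → Circle)
    (v : ZMod p → ℤ) (m : ZMod p) : Prop :=
  ∀ ζ ∉ singularSet B, g ζ ∉ singularSet B ∧ arcIndex p s (g ζ) = arcIndex p s ζ + m ∧
    φ (g ζ) = φ ζ + v (arcIndex p s (g ζ)) * (2 * π)

/-- The phase ranges allow a shift by `v` over a rotation by `m`. -/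
def IsCompatible (p : ℕ) (B : ℂ → ℂ) (s : ℤ → ℝ) (φ : Circle → ℝ)
    (v : ZMod p → ℤ) (m : ZMod p) : Prop :=
  ∀ j x, x ∈ phaseRange p B s φ j ↔ x + v (j + m) * (2 * π) ∈ phaseRange p B s φ (j + m)

namespace PhaseData

variable {p : ℕ} {B : ℂ → ℂ} {s : ℤ → ℝ} {φ : Circle → ℝ}

theorem exp_notMem (P : PhaseData p B s φ) {θ : ℝ} {i : ℤ} (h : θ ∈ Set.Ioo (s i) (s (i + 1))) :
    Circle.exp θ ∉ singularSet B :=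
  fun h' => P.notMem_range h ((P.mem_singularSet θ).1 h')

theorem arcIndex_exp_of_mem (P : PhaseData p B s φ) {θ : ℝ} {i : ℤ}
    (h : θ ∈ Set.Ioo (s i) (s (i + 1))) : arcIndex p s (Circle.exp θ) = i := by
  rw [P.arcIndex_exp, P.cutIndex_of_mem h]

theorem exists_angle (P : PhaseData p B s φ) {ζ : Circle} (hζ : ζ ∉ singularSet B) {i : ℤ}
    (hi : arcIndex p s ζ = i) : ∃ θ ∈ Set.Ioo (s i) (s (i + 1)), Circle.exp θ = ζ := by
  obtain ⟨θ, rfl⟩ := Circle.exp_surjective ζ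
  rw [P.arcIndex_exp] at hi
  have hθ := P.mem_Ioo_cutIndex fun h => hζ ((P.mem_singularSet θ).2 h)
  obtain ⟨n, hn⟩ := (ZMod.intCast_eq_intCast_iff_dvd_sub _ _ _).1 hi
  refine ⟨θ + n * (2 * π), ?_, Circle.exp_eq_exp.2 ⟨n, rfl⟩⟩
  have := P.add_mem_Ioo n hθ
  rwa [show cutIndex s θ + n * p = i by rw [mul_comm, ← hn]; ring] at this

theorem phaseRange_intCast (P : PhaseData p B s φ) (i : ℤ) :
    phaseRange p B s φ i = (fun θ => φ (Circle.exp θ)) '' Set.Ioo (s i) (s (i + 1)) := by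
  ext x
  constructor
  · rintro ⟨ζ, ⟨h1, h2⟩, rfl⟩
    obtain ⟨θ, hθ, rfl⟩ := P.exists_angle h1 h2
    exact ⟨θ, hθ, rfl⟩
  · rintro ⟨θ, hθ, rfl⟩
    exact ⟨_, ⟨P.exp_notMem hθ, P.arcIndex_exp_of_mem hθ⟩, rfl⟩

theorem phase_injective (P : PhaseData p B s φ) {ζ ξ : Circle} (hζ : ζ ∉ singularSet B)
    (hξ : ξ ∉ singularSet B) (h : arcIndex p s ζ = arcIndex p s ξ) (hφ : φ ζ = φ ξ) : ζ = ξ := by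
  obtain ⟨i, hi⟩ := ZMod.intCast_surjective (arcIndex p s ξ)
  obtain ⟨x, hx, rfl⟩ := P.exists_angle hζ (h.trans hi.symm)
  obtain ⟨y, hy, rfl⟩ := P.exists_angle hξ hi.symm
  rw [(P.strictMonoOn i).injOn hx hy hφ]

theorem exists_mem_arc (P : PhaseData p B s φ) (j : ZMod p) :
    ∃ ζ ∉ singularSet B, arcIndex p s ζ = j := by
  obtain ⟨i, rfl⟩ := ZMod.intCast_surjective j
  obtain ⟨θ, hθ⟩ := Set.nonempty_Ioo.2 (P.strictMono (lt_add_one i))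
  exact ⟨_, P.exp_notMem hθ, P.arcIndex_exp_of_mem hθ⟩

theorem int_of_phase (P : PhaseData p B s φ) {ζ ξ : Circle} (hζ : ζ ∉ singularSet B)
    (hξ : ξ ∉ singularSet B) (h : boundaryValue B ζ = boundaryValue B ξ) :
    ∃ n : ℤ, φ ζ = φ ξ + n * (2 * π) := by
  rw [← P.exp_phase ζ hζ, ← P.exp_phase ξ hξ] at h
  exact Circle.exp_eq_exp.1 (Subtype.ext h)

section Lift

variable {G : ℝ → ℝ} {i : ℤ}

/-- The image of an arc is connected and misses every cut. -/
theorem exists_mapsTo_Ioo (P : PhaseData p B s φ) (hG : Continuous G)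
    (hr : ∀ θ ∉ Set.range s, G θ ∉ Set.range s) (i : ℤ) :
    ∃ k : ℤ, Set.MapsTo G (Set.Ioo (s i) (s (i + 1))) (Set.Ioo (s k) (s (k + 1))) := by
  obtain ⟨θ₀, hθ₀⟩ := Set.nonempty_Ioo.2 (P.strictMono (lt_add_one i))
  set k := cutIndex s (G θ₀)
  have hk : G θ₀ ∈ Set.Ioo (s k) (s (k + 1)) := P.mem_Ioo_cutIndex (hr _ (P.notMem_range hθ₀))
  have hoc : (G '' Set.Ioo (s i) (s (i + 1))).OrdConnected :=
    (isPreconnected_Ioo.image G hG.continuousOn).ordConnected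
  have hne : ∀ l, s l ∉ G '' Set.Ioo (s i) (s (i + 1)) := by
    rintro l ⟨x, hx, hxl⟩
    exact hr x (P.notMem_range hx) ⟨l, hxl.symm⟩
  refine ⟨k, fun θ hθ => ⟨?_, ?_⟩⟩
  · by_contra! h
    exact hne k (hoc.out ⟨θ, hθ, rfl⟩ ⟨θ₀, hθ₀, rfl⟩ ⟨h, hk.1.le⟩)
  · by_contra! h
    exact hne (k + 1) (hoc.out ⟨θ₀, hθ₀, rfl⟩ ⟨θ, hθ, rfl⟩ ⟨hk.2.le, h⟩)

/-- The phase difference divided by `2π` is continuous and integer-valued on an interval. -/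
theorem exists_const_phase (P : PhaseData p B s φ) (hG : Continuous G) {k : ℤ}
    (hk : Set.MapsTo G (Set.Ioo (s i) (s (i + 1))) (Set.Ioo (s k) (s (k + 1))))
    (hb : ∀ θ ∈ Set.Ioo (s i) (s (i + 1)), boundaryValue B (Circle.exp (G θ)) =
      boundaryValue B (Circle.exp θ)) :
    ∃ n : ℤ, ∀ θ ∈ Set.Ioo (s i) (s (i + 1)),
      φ (Circle.exp (G θ)) = φ (Circle.exp θ) + n * (2 * π) := by
  have hπ := Real.two_pi_pos
  have hint : ∀ θ ∈ Set.Ioo (s i) (s (i + 1)), ∃ n : ℤ,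
      φ (Circle.exp (G θ)) = φ (Circle.exp θ) + n * (2 * π) := fun θ hθ =>
    P.int_of_phase (P.exp_notMem (hk hθ)) (P.exp_notMem hθ) (hb θ hθ)
  obtain ⟨θ₀, hθ₀⟩ := Set.nonempty_Ioo.2 (P.strictMono (lt_add_one i))
  obtain ⟨n, hn⟩ := hint θ₀ hθ₀
  refine ⟨n, fun θ hθ => ?_⟩
  set d : ℝ → ℝ := fun θ => (φ (Circle.exp (G θ)) - φ (Circle.exp θ)) / (2 * π) with hd
  have hdc : ContinuousOn d (Set.Ioo (s i) (s (i + 1))) :=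
    (((P.continuousOn k).comp hG.continuousOn hk).sub (P.continuousOn i)).div_const _
  have hmaps : Set.MapsTo d (Set.Ioo (s i) (s (i + 1))) (Set.range ((↑) : ℤ → ℝ)) := by
    intro θ hθ
    obtain ⟨l, hl⟩ := hint θ hθ
    exact ⟨l, by simp only [hd, hl]; field_simp; ring⟩
  have hdisc : DiscreteTopology (Set.range ((↑) : ℤ → ℝ)) :=
    Int.isClosedEmbedding_coe_real.isEmbedding.toHomeomorph.symm.isEmbedding.discreteTopology
  have h := isPreconnected_Ioo.constant_of_mapsTo ⟨hdisc⟩ hdc hmaps hθ hθ₀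
  simp only [hd, hn, add_sub_cancel_left] at h
  field_simp at h
  linarith

theorem strictMonoOn_lift (P : PhaseData p B s φ) {k n : ℤ}
    (hk : Set.MapsTo G (Set.Ioo (s i) (s (i + 1))) (Set.Ioo (s k) (s (k + 1))))
    (hn : ∀ θ ∈ Set.Ioo (s i) (s (i + 1)),
      φ (Circle.exp (G θ)) = φ (Circle.exp θ) + n * (2 * π)) :
    StrictMonoOn G (Set.Ioo (s i) (s (i + 1))) := by
  intro x hx y hy hxy
  have h : φ (Circle.exp (G x)) < φ (Circle.exp (G y)) := by
    rw [hn x hx, hn y hy]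
    have : φ (Circle.exp x) < φ (Circle.exp y) := P.strictMonoOn i hx hy hxy
    linarith
  exact ((P.strictMonoOn k).lt_iff_lt (hk hx) (hk hy)).1 h

/-- By monotonicity, the limit from the right puts `G (s i)` into `[s k, s (k + 1))`, whose only cut
is `s k`. -/
theorem lift_left (P : PhaseData p B s φ) (hG : Continuous G) {k : ℤ}
    (hs : G (s i) ∈ Set.range s)
    (hk : Set.MapsTo G (Set.Ioo (s i) (s (i + 1))) (Set.Ioo (s k) (s (k + 1))))
    (hm : StrictMonoOn G (Set.Ioo (s i) (s (i + 1)))) : G (s i) = s k := by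
  have hlt := P.strictMono (lt_add_one i)
  obtain ⟨θ, hθ⟩ := Set.nonempty_Ioo.2 hlt
  have ht : Tendsto G (𝓝[>] s i) (𝓝 (G (s i))) := (hG.tendsto _).mono_left nhdsWithin_le_nhds
  have hev : ∀ᶠ t in 𝓝[>] s i, t ∈ Set.Ioo (s i) θ := Ioo_mem_nhdsGT hθ.1
  have hsub : ∀ t ∈ Set.Ioo (s i) θ, t ∈ Set.Ioo (s i) (s (i + 1)) := fun t ht =>
    ⟨ht.1, ht.2.trans hθ.2⟩
  have h1 : s k ≤ G (s i) :=
    ge_of_tendsto ht (hev.mono fun t ht => (hk (hsub t ht)).1.le)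
  have h2 : G (s i) ≤ G θ :=
    le_of_tendsto ht (hev.mono fun t ht => (hm (hsub t ht) hθ ht.2).le)
  obtain ⟨l, hl⟩ := hs
  rw [← hl, ← P.cutIndex_cut l, hl, P.cutIndex_eq h1 (h2.trans_lt (hk hθ).2)]

theorem lift_right (P : PhaseData p B s φ) (hG : Continuous G) {k : ℤ}
    (hs : G (s (i + 1)) ∈ Set.range s)
    (hk : Set.MapsTo G (Set.Ioo (s i) (s (i + 1))) (Set.Ioo (s k) (s (k + 1))))
    (hm : StrictMonoOn G (Set.Ioo (s i) (s (i + 1)))) : G (s (i + 1)) = s (k + 1) := by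
  have hlt := P.strictMono (lt_add_one i)
  obtain ⟨θ, hθ⟩ := Set.nonempty_Ioo.2 hlt
  have ht : Tendsto G (𝓝[<] s (i + 1)) (𝓝 (G (s (i + 1)))) :=
    (hG.tendsto _).mono_left nhdsWithin_le_nhds
  have hev : ∀ᶠ t in 𝓝[<] s (i + 1), t ∈ Set.Ioo θ (s (i + 1)) := Ioo_mem_nhdsLT hθ.2
  have hsub : ∀ t ∈ Set.Ioo θ (s (i + 1)), t ∈ Set.Ioo (s i) (s (i + 1)) := fun t ht =>
    ⟨hθ.1.trans ht.1, ht.2⟩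
  have h1 : G (s (i + 1)) ≤ s (k + 1) :=
    le_of_tendsto ht (hev.mono fun t ht => (hk (hsub t ht)).2.le)
  have h2 : G θ ≤ G (s (i + 1)) :=
    ge_of_tendsto ht (hev.mono fun t ht => (hm hθ (hsub t ht) ht.1).le)
  obtain ⟨l, hl⟩ := hs
  rw [← hl] at h1 h2 ⊢
  have h3 := P.strictMono.lt_iff_lt.1 ((hk hθ).1.trans_le h2)
  have h4 := P.strictMono.le_iff_le.1 h1
  congr 1
  omega

end Lift

/-- Every invariant rotates the arcs and shifts the phase by integral multiples of `2π`. -/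
theorem exists_isShift (P : PhaseData p B s φ) {g : Function.End Circle} (hg : g ∈ invariants B) :
    ∃ v m, IsShift p B s φ g v m ∧ IsCompatible p B s φ v m := by
  obtain ⟨hgc, hgs, hgr⟩ := hg
  have : NeZero p := ⟨P.pos.ne'⟩
  let f : C(ℝ, Circle) := ⟨fun θ => g (Circle.exp θ), hgc.comp Circle.exp.continuous⟩
  -- Lifting through the covering `Circle.exp` makes order arguments on the line available.
  obtain ⟨G, ⟨-, hGf⟩, -⟩ := Circle.isCoveringMap_exp.existsUnique_continuousMap_lifts f 0
    (f 0 : ℂ).arg (Circle.exp_arg _)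
  have hG : ∀ θ, Circle.exp (G θ) = g (Circle.exp θ) := fun θ => congrFun hGf θ
  have hS : ∀ i, G (s i) ∈ Set.range s := fun i => by
    rw [← P.mem_singularSet, hG]
    exact hgs _ ((P.mem_singularSet _).2 ⟨i, rfl⟩)
  have hR : ∀ θ ∉ Set.range s, G θ ∉ Set.range s := fun θ hθ => by
    rw [← P.mem_singularSet, hG]
    exact (hgr _ fun h => hθ ((P.mem_singularSet _).1 h)).1
  choose κ hκ using P.exists_mapsTo_Ioo G.continuous hR
  choose n hn using fun i => P.exists_const_phase (i := i) G.continuous (hκ i) fun θ hθ => by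
    rw [hG]; exact (hgr _ (P.exp_notMem hθ)).2
  have hm := fun i => P.strictMonoOn_lift (hκ i) (hn i)
  have hleft := fun i => P.lift_left G.continuous (hS i) (hκ i) (hm i)
  have hright := fun i => P.lift_right G.continuous (hS (i + 1)) (hκ i) (hm i)
  -- The right end of one arc is the left end of the next, so neighbouring arcs have neighbouring
  -- targets.
  have hsucc : ∀ i, κ (i + 1) = κ i + 1 := fun i =>
    P.strictMono.injective ((hleft (i + 1)).symm.trans (hright i))
  have hκ0 : ∀ i, κ i = i + κ 0 := fun i => by
    induction i using Int.induction_on with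
    | zero => simp
    | succ i ih => rw [hsucc, ih]; ring
    | pred i ih =>
      have := hsucc (-(i : ℤ) - 1)
      rw [sub_add_cancel, ih] at this
      linarith
  have hsurj : ∀ i, ∀ y ∈ Set.Ioo (s (κ i)) (s (κ i + 1)),
      ∃ θ ∈ Set.Ioo (s i) (s (i + 1)), G θ = y := fun i y hy => by
    rw [← hleft i, ← hright i] at hy
    exact intermediate_value_Ioo (P.strictMono (lt_add_one i)).le G.continuous.continuousOn hy
  -- `v` is indexed by the arc of arrival, hence the subtraction. Only the representatives in `[0,
  -- p)` matter, since every regular point has an angle in such an arc.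
  set v : ZMod p → ℤ := fun j => n ((j - (κ 0 : ZMod p)).val : ℤ) with hv
  have hval : ∀ j : ZMod p, (((j.val : ℕ) : ℤ) : ZMod p) = j := fun j => by simp
  have hvval : ∀ j : ZMod p, v (j + (κ 0 : ZMod p)) = n (j.val : ℤ) := fun j => by simp [hv]
  have hκc : ∀ j : ZMod p, ((κ (j.val : ℤ) : ℤ) : ZMod p) = j + (κ 0 : ZMod p) := fun j => by
    rw [hκ0]; simp
  refine ⟨v, (κ 0 : ZMod p), fun ζ hζ => ?_, fun j x => ?_⟩
  · obtain ⟨θ, hθ, hθζ⟩ := P.exists_angle hζ (hval (arcIndex p s ζ)).symm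
    have h1 := hκ _ hθ
    have h2 := hn _ θ hθ
    have h3 := P.arcIndex_exp_of_mem h1
    rw [hG, hθζ] at h2 h3
    rw [hκc] at h3
    exact ⟨(hgr ζ hζ).1, h3, by rw [h3, hvval, h2]⟩
  · rw [hvval, ← hκc, P.phaseRange_intCast]
    have e : phaseRange p B s φ j = phaseRange p B s φ ((j.val : ℤ) : ZMod p) := by rw [hval]
    rw [e, P.phaseRange_intCast]
    constructor
    · rintro ⟨θ, hθ, rfl⟩
      exact ⟨G θ, hκ _ hθ, hn _ θ hθ⟩
    · rintro ⟨y, hy, hyx⟩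
      obtain ⟨θ, hθ, rfl⟩ := hsurj _ y hy
      have := hn _ θ hθ
      exact ⟨θ, hθ, by simp only at hyx ⊢; linarith⟩

/-- Every admissible rotation of the arcs with a shift of the phase comes from an invariant. -/
theorem exists_invariant (P : PhaseData p B s φ) {v : ZMod p → ℤ} {m : ZMod p}
    (h : IsCompatible p B s φ v m) : ∃ g ∈ invariants B, IsShift p B s φ g v m := by
  obtain ⟨k, rfl⟩ := ZMod.intCast_surjective m
  set ψ : ℝ → ℝ := fun θ => φ (Circle.exp θ) with hψ
  have hex : ∀ θ : ℝ, ∃ y : ℝ, (θ ∈ Set.range s → y = s (cutIndex s θ + k)) ∧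
      (θ ∉ Set.range s → y ∈ Set.Ioo (s (cutIndex s θ + k)) (s (cutIndex s θ + k + 1)) ∧
        ψ y = ψ θ + v ((cutIndex s θ + k : ℤ) : ZMod p) * (2 * π)) := fun θ => by
    by_cases hθ : θ ∈ Set.range s
    · exact ⟨_, fun _ => rfl, fun h => absurd hθ h⟩
    · have h1 : ψ θ ∈ phaseRange p B s φ (cutIndex s θ : ZMod p) := by
        rw [P.phaseRange_intCast]; exact ⟨θ, P.mem_Ioo_cutIndex hθ, rfl⟩
      have h2 := (h _ _).1 h1
      rw [← Int.cast_add, P.phaseRange_intCast] at h2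
      obtain ⟨y, hy, hyψ⟩ := h2
      exact ⟨y, fun h => absurd h hθ, fun _ => ⟨hy, hyψ⟩⟩
  choose G hGs hGr using hex
  have hGcut : ∀ i, G (s i) = s (i + k) := fun i => by rw [hGs _ ⟨i, rfl⟩, P.cutIndex_cut]
  have hGarc : ∀ i, ∀ θ ∈ Set.Ioo (s i) (s (i + 1)),
      G θ ∈ Set.Ioo (s (i + k)) (s (i + k + 1)) ∧
        ψ (G θ) = ψ θ + v ((i + k : ℤ) : ZMod p) * (2 * π) := fun i θ hθ => by
    have := hGr θ (P.notMem_range hθ)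
    rwa [P.cutIndex_of_mem hθ] at this
  have hcases : ∀ θ : ℝ, (∃ i, θ = s i) ∨ ∃ i, θ ∈ Set.Ioo (s i) (s (i + 1)) := fun θ => by
    by_cases hθ : θ ∈ Set.range s
    · obtain ⟨i, rfl⟩ := hθ
      exact Or.inl ⟨i, rfl⟩
    · exact Or.inr ⟨_, P.mem_Ioo_cutIndex hθ⟩
  have hGI : ∀ θ, s (cutIndex s θ + k) ≤ G θ ∧ G θ < s (cutIndex s θ + k + 1) := fun θ => by
    rcases hcases θ with ⟨i, rfl⟩ | ⟨i, hi⟩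
    · rw [hGcut, P.cutIndex_cut]
      exact ⟨le_rfl, P.strictMono (lt_add_one _)⟩
    · rw [P.cutIndex_of_mem hi]
      exact ⟨(hGarc i θ hi).1.1.le, (hGarc i θ hi).1.2⟩
  -- Continuity of `G`, also at the cuts, will come for free: a monotone surjection of the line is
  -- continuous.
  have hmono : StrictMono G := fun x y hxy => by
    obtain ⟨hx1, hx2⟩ := P.cutIndex_spec x
    obtain ⟨hy1, hy2⟩ := P.cutIndex_spec y
    have hle := P.strictMono.lt_iff_lt.1 (hx1.trans_lt (hxy.trans hy2))
    rcases (Int.lt_add_one_iff.1 hle).lt_or_eq with hlt | heq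
    · calc G x < s (cutIndex s x + k + 1) := (hGI x).2
        _ ≤ s (cutIndex s y + k) := P.strictMono.monotone (by omega)
        _ ≤ G y := (hGI y).1
    · have hy : y ∈ Set.Ioo (s (cutIndex s y)) (s (cutIndex s y + 1)) :=
        ⟨(heq ▸ hx1).trans_lt hxy, hy2⟩
      have hGy := hGarc _ y hy
      rcases hcases x with ⟨i, rfl⟩ | ⟨i, hi⟩
      · rw [P.cutIndex_cut] at heq
        rw [hGcut, heq]
        exact hGy.1.1
      · rw [P.cutIndex_of_mem hi] at heq
        rw [← heq] at hGy hy
        have hGx := hGarc i x hi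
        refine ((P.strictMonoOn (i + k)).lt_iff_lt hGx.1 hGy.1).1 ?_
        have h1 : ψ x < ψ y := P.strictMonoOn i hi hy hxy
        have h2 := hGx.2
        have h3 := hGy.2
        simp only [hψ] at h1 h2 h3 ⊢
        linarith
  have hsurj : Function.Surjective G := fun y => by
    rcases hcases y with ⟨i, rfl⟩ | ⟨i, hi⟩
    · exact ⟨s (i - k), by rw [hGcut, sub_add_cancel]⟩
    · have h1 : ψ y ∈ phaseRange p B s φ (i : ZMod p) := by
        rw [P.phaseRange_intCast]; exact ⟨y, hi, rfl⟩
      have h2 := h ((i - k : ℤ) : ZMod p) (ψ y - v (i : ZMod p) * (2 * π))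
      rw [← Int.cast_add, sub_add_cancel, sub_add_cancel, P.phaseRange_intCast] at h2
      obtain ⟨θ, hθ, hθy⟩ := h2.2 h1
      have h3 := hGarc _ θ hθ
      rw [sub_add_cancel] at h3
      refine ⟨θ, (P.strictMonoOn i).injOn h3.1 hi ?_⟩
      have h4 := h3.2
      simp only [hψ] at h4 hθy ⊢
      linarith
  have hcont : Continuous G := hmono.monotone.continuous_of_surjective hsurj
  have hper : ∀ θ (n : ℤ), Circle.exp (G (θ + n * (2 * π))) = Circle.exp (G θ) := fun θ n => by
    rcases hcases θ with ⟨i, rfl⟩ | ⟨i, hi⟩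
    · rw [← P.period_mul, hGcut, hGcut, add_right_comm, P.period_mul]
      exact Circle.exp_eq_exp.2 ⟨n, rfl⟩
    · have h1 := hGarc _ _ (P.add_mem_Ioo n hi)
      have h2 := hGarc _ _ hi
      refine P.phase_injective (P.exp_notMem h1.1) (P.exp_notMem h2.1) ?_ ?_
      · rw [P.arcIndex_exp_of_mem h1.1, P.arcIndex_exp_of_mem h2.1]; simp
      · have h3 := h1.2
        have h4 := h2.2
        have h5 : Circle.exp (θ + n * (2 * π)) = Circle.exp θ := Circle.exp_eq_exp.2 ⟨n, rfl⟩
        simp only [hψ, h5] at h3 h4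
        rw [h3, h4]; simp
  set g : Function.End Circle := fun ζ => Circle.exp (G (ζ : ℂ).arg) with hg
  have hgexp : ∀ θ, g (Circle.exp θ) = Circle.exp (G θ) := fun θ => by
    obtain ⟨n, hn⟩ := Circle.exp_eq_exp.1 (Circle.exp_arg (Circle.exp θ))
    simp only [hg, hn, hper]
  have hshift : IsShift p B s φ g v (k : ZMod p) := fun ζ hζ => by
    obtain ⟨θ, rfl⟩ := Circle.exp_surjective ζ
    have hθ := P.mem_Ioo_cutIndex fun h => hζ ((P.mem_singularSet θ).2 h)
    have h1 := hGarc _ θ hθ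
    rw [hgexp, P.arcIndex_exp_of_mem h1.1, P.arcIndex_exp]
    exact ⟨P.exp_notMem h1.1, by push_cast; rfl, h1.2⟩
  refine ⟨g, ⟨?_, fun ζ hζ => ?_, fun ζ hζ => ⟨(hshift ζ hζ).1, ?_⟩⟩, hshift⟩
  -- `g` is written with the discontinuous `arg`, so its continuity is checked after composing with
  -- the quotient map `Circle.exp`.
  · have hq : IsQuotientMap Circle.exp :=
      Circle.isCoveringMap_exp.isOpenMap.isQuotientMap Circle.exp.continuous Circle.exp_surjective
    refine hq.continuous_iff.2 ?_
    have : g ∘ Circle.exp = Circle.exp ∘ G := funext hgexp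
    rw [this]
    exact Circle.exp.continuous.comp hcont
  · obtain ⟨θ, rfl⟩ := Circle.exp_surjective ζ
    obtain ⟨i, rfl⟩ := (P.mem_singularSet θ).1 hζ
    rw [hgexp, hGcut]
    exact (P.mem_singularSet _).2 ⟨_, rfl⟩
  · rw [← P.exp_phase _ (hshift ζ hζ).1, ← P.exp_phase ζ hζ, (hshift ζ hζ).2.2]
    congr 1
    exact Circle.exp_eq_exp.2 ⟨_, rfl⟩

end PhaseData

end BlaschkeInvariants

/-! ### Type 2 arcs and the range of the phase -/

namespace BlaschkeInvariants

open scoped Real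

namespace PhaseData

variable {p : ℕ} {B : ℂ → ℂ} {s : ℤ → ℝ} {φ : Circle → ℝ}

theorem boundaryValue_eq_one_iff (P : PhaseData p B s φ) {ζ : Circle} (hζ : ζ ∉ singularSet B) :
    boundaryValue B ζ = 1 ↔ ∃ n : ℤ, φ ζ = n * (2 * π) := by
  rw [← P.exp_phase ζ hζ, ← Circle.exp_eq_one]
  exact ⟨fun h => Subtype.ext h, fun h => by rw [h]; rfl⟩

theorem ordConnected_phaseRange (P : PhaseData p B s φ) (j : ZMod p) :
    (phaseRange p B s φ j).OrdConnected := by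
  obtain ⟨i, rfl⟩ := ZMod.intCast_surjective j
  rw [P.phaseRange_intCast]
  exact (isPreconnected_Ioo.image _ (P.continuousOn i)).ordConnected

theorem phaseRange_nonempty (P : PhaseData p B s φ) (j : ZMod p) :
    (phaseRange p B s φ j).Nonempty := by
  obtain ⟨ζ, h1, h2⟩ := P.exists_mem_arc j
  exact ⟨_, ζ, ⟨h1, h2⟩, rfl⟩

theorem isComplementaryArc_iff (P : PhaseData p B s φ) {α β : ℝ} :
    IsComplementaryArc B α β ↔ ∃ i, α = s i ∧ β = s (i + 1) := by
  constructor
  · rintro ⟨hlt, hα, hβ, h⟩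
    obtain ⟨i, rfl⟩ := (P.mem_singularSet _).1 hα
    obtain ⟨k, rfl⟩ := (P.mem_singularSet _).1 hβ
    refine ⟨i, rfl, ?_⟩
    have hik := P.strictMono.lt_iff_lt.1 hlt
    by_contra hne
    have hk : i + 1 < k := lt_of_le_of_ne hik fun e => hne (by rw [e])
    exact h (s (i + 1)) ⟨P.strictMono (lt_add_one i), P.strictMono hk⟩
      ((P.mem_singularSet _).2 ⟨_, rfl⟩)
  · rintro ⟨i, rfl, rfl⟩
    exact ⟨P.strictMono (lt_add_one i), (P.mem_singularSet _).2 ⟨_, rfl⟩,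
      (P.mem_singularSet _).2 ⟨_, rfl⟩, fun θ hθ => P.exp_notMem hθ⟩

/-- The solutions of `B = 1` in an arc are isolated inside the arc. -/
theorem not_accPt_of_mem (P : PhaseData p B s φ) {i : ℤ} {t : ℝ}
    (ht : t ∈ Set.Ioo (s i) (s (i + 1))) :
    ¬ AccPt t (𝓟 {θ | θ ∈ Set.Ioo (s i) (s (i + 1)) ∧ boundaryValue B (Circle.exp θ) = 1}) := by
  intro hacc
  rw [accPt_iff_nhds] at hacc
  have hπ := Real.pi_pos
  have hI : Set.Ioo (s i) (s (i + 1)) ∈ 𝓝 t := isOpen_Ioo.mem_nhds ht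
  have hc : ContinuousAt (fun θ => φ (Circle.exp θ)) t := (P.continuousOn i).continuousAt hI
  -- Two solutions here have phases less than `2π` apart, both in `2πℤ`. The phases are then equal,
  -- and so are the solutions.
  have hU : {θ | |φ (Circle.exp θ) - φ (Circle.exp t)| < π} ∈ 𝓝 t := by
    filter_upwards [hc.eventually (Metric.ball_mem_nhds _ hπ)] with x hx
    simpa only [Metric.mem_ball, Real.dist_eq] using hx
  obtain ⟨y, ⟨hyU, hyI, hy1⟩, hyt⟩ := hacc _ hU
  have hV : {θ | |φ (Circle.exp θ) - φ (Circle.exp t)| < π} ∩ {y}ᶜ ∈ 𝓝 t :=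
    inter_mem hU (isOpen_compl_singleton.mem_nhds hyt.symm)
  obtain ⟨z, ⟨⟨hzU, hzy⟩, hzI, hz1⟩, -⟩ := hacc _ hV
  obtain ⟨k, hk⟩ := (P.boundaryValue_eq_one_iff (P.exp_notMem hyI)).1 hy1
  obtain ⟨l, hl⟩ := (P.boundaryValue_eq_one_iff (P.exp_notMem hzI)).1 hz1
  rw [Set.mem_ofPred_eq, hk, abs_lt] at hyU
  rw [Set.mem_ofPred_eq, hl, abs_lt] at hzU
  have h1 : (k : ℝ) < l + 1 := by nlinarith
  have h2 : (l : ℝ) < k + 1 := by nlinarith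
  have hkl : k = l := by
    have h1' : k < l + 1 := by exact_mod_cast h1
    have h2' : l < k + 1 := by exact_mod_cast h2
    omega
  exact hzy ((P.strictMonoOn i).injOn hzI hyI (by simp only [hk, hl, hkl]))

/-- An arc is of type 2 if and only if the phase takes every real value on it. -/
theorem isTypeTwo_iff (P : PhaseData p B s φ) (i : ℤ) :
    IsTypeTwo B (s i) (s (i + 1)) ↔ phaseRange p B s φ (i : ZMod p) = Set.univ := by
  have hπ := Real.two_pi_pos
  have hlt : s i < s (i + 1) := P.strictMono (lt_add_one i)
  set E := {θ | θ ∈ Set.Ioo (s i) (s (i + 1)) ∧ boundaryValue B (Circle.exp θ) = 1} with hE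
  have hphase : ∀ θ ∈ E, ∃ n : ℤ, φ (Circle.exp θ) = n * (2 * π) := fun θ hθ =>
    (P.boundaryValue_eq_one_iff (P.exp_notMem hθ.1)).1 hθ.2
  have hlt_phase : ∀ x ∈ E, ∀ y ∈ E, x < y →
      φ (Circle.exp x) ≤ φ (Circle.exp y) - 2 * π := fun x hx y hy hxy => by
    obtain ⟨k, hk⟩ := hphase x hx
    obtain ⟨l, hl⟩ := hphase y hy
    have h : φ (Circle.exp x) < φ (Circle.exp y) := P.strictMonoOn i hx.1 hy.1 hxy
    rw [hk, hl] at h ⊢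
    have h1 : (k : ℝ) < l := lt_of_mul_lt_mul_right h hπ.le
    have h2 : (k : ℝ) + 1 ≤ l := by exact_mod_cast h1
    nlinarith
  constructor
  · intro h
    have hacc : ∀ t ∈ ({s i, s (i + 1)} : Set ℝ), AccPt t (𝓟 E) := fun t ht => by
      rw [← h] at ht
      exact ht
    have hα := accPt_iff_nhds.1 (hacc (s i) (by simp))
    have hβ := accPt_iff_nhds.1 (hacc (s (i + 1)) (by simp))
    obtain ⟨θ₀, ⟨-, hθ₀⟩, -⟩ := hα _ univ_mem
    -- Each further solution towards the left end costs at least `2π` of phase; together with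
    -- `hhigh` the range is unbounded both ways, and it is an interval.
    have hlow : ∀ N : ℕ, ∃ θ ∈ E, φ (Circle.exp θ) ≤ φ (Circle.exp θ₀) - N * (2 * π) := by
      intro N
      induction N with
      | zero => exact ⟨θ₀, hθ₀, by simp⟩
      | succ N ih =>
        obtain ⟨θ, hθ, hle⟩ := ih
        obtain ⟨θ', ⟨hθ'1, hθ'⟩, -⟩ := hα _ (Iio_mem_nhds hθ.1.1)
        have := hlt_phase θ' hθ' θ hθ hθ'1
        exact ⟨θ', hθ', by push_cast; linarith⟩
    have hhigh : ∀ N : ℕ, ∃ θ ∈ E, φ (Circle.exp θ₀) + N * (2 * π) ≤ φ (Circle.exp θ) := by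
      intro N
      induction N with
      | zero => exact ⟨θ₀, hθ₀, by simp⟩
      | succ N ih =>
        obtain ⟨θ, hθ, hle⟩ := ih
        obtain ⟨θ', ⟨hθ'1, hθ'⟩, -⟩ := hβ _ (Ioi_mem_nhds hθ.1.2)
        have := hlt_phase θ hθ θ' hθ' hθ'1
        exact ⟨θ', hθ', by push_cast; linarith⟩
    refine Set.eq_univ_of_forall fun x => ?_
    obtain ⟨N, hN⟩ := exists_nat_gt (|x - φ (Circle.exp θ₀)| / (2 * π))
    rw [div_lt_iff₀ hπ] at hN
    obtain ⟨y, hy, hyN⟩ := hlow N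
    obtain ⟨z, hz, hzN⟩ := hhigh N
    have h1 := le_abs_self (x - φ (Circle.exp θ₀))
    have h2 := neg_abs_le (x - φ (Circle.exp θ₀))
    refine (P.ordConnected_phaseRange i).out (x := φ (Circle.exp y)) (y := φ (Circle.exp z))
      ?_ ?_ ⟨by linarith, by linarith⟩
    · rw [P.phaseRange_intCast]; exact ⟨y, hy.1, rfl⟩
    · rw [P.phaseRange_intCast]; exact ⟨z, hz.1, rfl⟩
  · intro h
    have hval : ∀ n : ℤ, ∃ θ ∈ E, φ (Circle.exp θ) = n * (2 * π) := fun n => by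
      have : (n * (2 * π) : ℝ) ∈ phaseRange p B s φ (i : ZMod p) := h ▸ Set.mem_univ _
      rw [P.phaseRange_intCast] at this
      obtain ⟨θ, hθ, hn⟩ := this
      exact ⟨θ, ⟨hθ, (P.boundaryValue_eq_one_iff (P.exp_notMem hθ)).2 ⟨n, hn⟩⟩, hn⟩
    refine Set.Subset.antisymm (fun t ht => ?_) ?_
    · have ht' : AccPt t (𝓟 E) := ht
      have hcl : t ∈ Set.Icc (s i) (s (i + 1)) := by
        rw [← closure_Ioo hlt.ne]
        exact closure_mono (fun θ hθ => hθ.1) (mem_closure_iff_clusterPt.2 ht'.clusterPt)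
      by_contra hne
      simp only [Set.mem_insert_iff, Set.mem_singleton_iff, not_or] at hne
      exact P.not_accPt_of_mem ⟨lt_of_le_of_ne hcl.1 (Ne.symm hne.1),
        lt_of_le_of_ne hcl.2 hne.2⟩ ht'
    -- A solution with phase `2πn` and `n` small enough lies to the left of any given point of the
    -- arc, and symmetrically on the right.
    · rintro t (rfl | rfl)
      · refine accPt_iff_nhds.2 fun U hU => ?_
        obtain ⟨u, hu, hsub⟩ := exists_Ico_subset_of_mem_nhds hU ⟨_, hlt⟩
        obtain ⟨θ, hθ1, hθ2⟩ := exists_between (lt_min hu hlt)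
        obtain ⟨n, hn⟩ := exists_int_lt (φ (Circle.exp θ) / (2 * π))
        rw [lt_div_iff₀ hπ] at hn
        obtain ⟨y, hy, hyn⟩ := hval n
        have hyθ : y < θ := ((P.strictMonoOn i).lt_iff_lt hy.1
          ⟨hθ1, hθ2.trans_le (min_le_right _ _)⟩).1 (by simpa only [hyn] using hn)
        exact ⟨y, ⟨hsub ⟨hy.1.1.le, hyθ.trans (hθ2.trans_le (min_le_left _ _))⟩, hy⟩, hy.1.1.ne'⟩
      · refine accPt_iff_nhds.2 fun U hU => ?_
        obtain ⟨u, hu, hsub⟩ := exists_Ioc_subset_of_mem_nhds hU ⟨_, hlt⟩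
        obtain ⟨θ, hθ1, hθ2⟩ := exists_between (max_lt hu hlt)
        obtain ⟨n, hn⟩ := exists_int_gt (φ (Circle.exp θ) / (2 * π))
        rw [div_lt_iff₀ hπ] at hn
        obtain ⟨y, hy, hyn⟩ := hval n
        have hyθ : θ < y := ((P.strictMonoOn i).lt_iff_lt
          ⟨(le_max_right _ _).trans_lt hθ1, hθ2⟩ hy.1).1 (by simpa only [hyn] using hn)
        exact ⟨y, ⟨hsub ⟨((le_max_left _ _).trans_lt hθ1).trans hyθ, hy.1.2.le⟩, hy⟩, hy.1.2.ne⟩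

/-- Pairs `(α, β)` differing by full turns give the same subset of the circle, and distinct residues
give distinct subsets. -/
theorem numTypeTwo_eq (P : PhaseData p B s φ) :
    numTypeTwo B = {j | phaseRange p B s φ j = Set.univ}.ncard := by
  set A : ZMod p → Set Circle := fun j => {ζ | ζ ∉ singularSet B ∧ arcIndex p s ζ = j} with hA
  have hinj : Function.Injective A := fun j k hjk => by
    obtain ⟨ζ, h1, h2⟩ := P.exists_mem_arc j
    have h3 : ζ ∈ A k := hjk ▸ ⟨h1, h2⟩
    exact h2.symm.trans h3.2
  have himg : ∀ i : ℤ, Circle.exp '' Set.Ioo (s i) (s (i + 1)) = A i := fun i => by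
    ext ζ
    constructor
    · rintro ⟨θ, hθ, rfl⟩
      exact ⟨P.exp_notMem hθ, P.arcIndex_exp_of_mem hθ⟩
    · rintro ⟨h1, h2⟩
      exact P.exists_angle h1 h2
  rw [numTypeTwo, ← Set.ncard_image_of_injective _ hinj]
  congr 1
  ext I
  constructor
  · rintro ⟨α, β, h1, h2, rfl⟩
    obtain ⟨i, rfl, rfl⟩ := P.isComplementaryArc_iff.1 h1
    exact ⟨i, (P.isTypeTwo_iff i).1 h2, (himg i).symm⟩
  · rintro ⟨j, hj, rfl⟩
    obtain ⟨i, rfl⟩ := ZMod.intCast_surjective j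
    exact ⟨s i, s (i + 1), P.isComplementaryArc_iff.2 ⟨i, rfl, rfl⟩, (P.isTypeTwo_iff i).2 hj,
      (himg i).symm⟩

end PhaseData

end BlaschkeInvariants

/-! ### The presentation of the semidirect product -/

namespace BlaschkeInvariants

section Presentation

variable (n : ℕ)

/-- The group `ℤ ^ n ⋊ ℤ_n`, in which `ℤ_n` acts by cyclic shifts. -/
abbrev ShiftGroup : Type :=
  Multiplicative (ZMod n → ℤ) ⋊[cyclicShift n] Multiplicative (ZMod n)

/-- The unit vectors of `ℤ ^ n`. -/
def unitVector (j : ZMod n) : Multiplicative (ZMod n → ℤ) := Multiplicative.ofAdd (Pi.single j 1)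

theorem cyclicShift_unitVector (j : ZMod n) :
    cyclicShift n (Multiplicative.ofAdd 1) (unitVector n j) = unitVector n (j + 1) := by
  apply Multiplicative.toAdd.injective
  funext k
  change (Pi.single j 1 : ZMod n → ℤ) (k - 1) = (Pi.single (j + 1) 1 : ZMod n → ℤ) k
  simp only [Pi.single_apply, sub_eq_iff_eq_add]

/-- The images of the generators in `ℤ ^ n ⋊ ℤ_n`. -/
def genImage : Gen n → ShiftGroup n
  | Gen.x j => SemidirectProduct.inl (unitVector n j)
  | Gen.y => SemidirectProduct.inr (Multiplicative.ofAdd 1)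

theorem lift_genImage_relator : ∀ w ∈ {w | Relators n w}, FreeGroup.lift (genImage n) w = 1 := by
  rintro _ (_ | ⟨j, k⟩ | ⟨j⟩)
  · rw [map_pow, FreeGroup.lift_apply_of, genImage, ← map_pow, ← ofAdd_nsmul]
    simp
  · simp only [map_mul, map_inv, FreeGroup.lift_apply_of, genImage]
    rw [← map_mul, ← map_mul, mul_comm, mul_inv_cancel]
  · simp only [map_mul, map_inv, FreeGroup.lift_apply_of, genImage]
    rw [← cyclicShift_unitVector, SemidirectProduct.inl_aut, map_inv, inv_mul_cancel_right,
      mul_inv_cancel]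

/-- The generator `x_j` of the presented group. -/
abbrev presX (j : ZMod n) : ShiftPresentation n := PresentedGroup.of (Gen.x j)

/-- The generator `y` of the presented group. -/
abbrev presY : ShiftPresentation n := PresentedGroup.of Gen.y

theorem presY_pow : presY n ^ n = 1 :=
  PresentedGroup.one_of_mem (rels := {w | Relators n w}) Relators.order

theorem presX_commute (j k : ZMod n) : Commute (presX n j) (presX n k) :=
  mul_inv_eq_one.1 (PresentedGroup.one_of_mem (rels := {w | Relators n w}) (Relators.comm j k))

theorem presY_mul_presX (j : ZMod n) : presY n * presX n j = presX n (j + 1) * presY n :=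
  mul_inv_eq_one.1 (PresentedGroup.one_of_mem (rels := {w | Relators n w}) (Relators.shift j))

variable {n}

theorem hom_ext_unitVector [NeZero n] {G : Type*} [Group G]
    {f g : Multiplicative (ZMod n → ℤ) →* G} (h : ∀ j, f (unitVector n j) = g (unitVector n j)) :
    f = g := by
  have e : f.comp (MulEquiv.piMultiplicative fun _ : ZMod n => ℤ).symm.toMonoidHom =
      g.comp (MulEquiv.piMultiplicative fun _ : ZMod n => ℤ).symm.toMonoidHom := by
    refine MonoidHom.pi_ext fun j x => ?_
    have hx : (MulEquiv.piMultiplicative fun _ : ZMod n => ℤ).symm (Pi.mulSingle j x) =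
        unitVector n j ^ x.toAdd := by
      apply Multiplicative.toAdd.injective
      funext k
      simp only [unitVector, ← ofAdd_zsmul, toAdd_ofAdd, Pi.smul_apply, Pi.single_apply]
      change Multiplicative.toAdd ((Pi.mulSingle j x : ZMod n → Multiplicative ℤ) k) = _
      rw [Pi.mulSingle_apply]
      split_ifs <;> simp
    simp only [MonoidHom.comp_apply, MulEquiv.toMonoidHom_eq_coe, MonoidHom.coe_coe, hx, map_zpow,
      h]
  refine MonoidHom.ext fun v => ?_
  have := DFunLike.congr_fun e ((MulEquiv.piMultiplicative fun _ : ZMod n => ℤ) v)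
  simpa using this

variable (n)

theorem exists_hom_vectors [NeZero n] :
    ∃ f : Multiplicative (ZMod n → ℤ) →* ShiftPresentation n,
      ∀ j, f (unitVector n j) = presX n j := by
  have hcomm : Pairwise fun i j : ZMod n => ∀ x y : Multiplicative ℤ,
      Commute (zpowersHom _ (presX n i) x) (zpowersHom _ (presX n j) y) := fun i j _ x y => by
    simp only [zpowersHom_apply]
    exact ((presX_commute n i j).zpow_zpow _ _)
  refine ⟨(MonoidHom.noncommPiCoprod (fun j : ZMod n => zpowersHom _ (presX n j)) hcomm).comp
    (MulEquiv.piMultiplicative fun _ : ZMod n => ℤ).toMonoidHom, fun j => ?_⟩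
  have : (MulEquiv.piMultiplicative fun _ : ZMod n => ℤ) (unitVector n j) =
      Pi.mulSingle j (Multiplicative.ofAdd 1) := by
    funext k
    change Multiplicative.ofAdd ((Pi.single j 1 : ZMod n → ℤ) k) = _
    rw [Pi.mulSingle_apply, Pi.single_apply]
    split_ifs <;> rfl
  simp only [MonoidHom.comp_apply, MulEquiv.toMonoidHom_eq_coe, MonoidHom.coe_coe, this]
  rw [MonoidHom.noncommPiCoprod_mulSingle]
  simp

theorem exists_hom_rotations :
    ∃ f : Multiplicative (ZMod n) →* ShiftPresentation n,
      f (Multiplicative.ofAdd 1) = presY n := by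
  let z : ℤ →+ Additive (ShiftPresentation n) := zmultiplesHom _ (Additive.ofMul (presY n))
  have hz : z n = 0 := by
    simp only [z, zmultiplesHom_apply, natCast_zsmul, ← ofMul_pow, presY_pow, ofMul_one]
  refine ⟨AddMonoidHom.toMultiplicativeLeft (ZMod.lift n ⟨z, hz⟩), ?_⟩
  have : ZMod.lift n ⟨z, hz⟩ 1 = z 1 := by
    have := ZMod.lift_coe n ⟨z, hz⟩ 1
    simpa using this
  change Additive.toMul (ZMod.lift n ⟨z, hz⟩ 1) = _
  rw [this]
  simp [z]

theorem ofAdd_eq_pow [NeZero n] (g : Multiplicative (ZMod n)) :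
    g = Multiplicative.ofAdd (1 : ZMod n) ^ g.toAdd.val := by
  rw [← ofAdd_nsmul]
  simp

/-- The relators hold in the semidirect product, which gives one homomorphism. For the inverse,
conjugation by `y` must act as the cyclic shift: this is checked on unit vectors and then iterated
over powers of `y`. Both composites fix generators. -/
theorem nonempty_equiv_presentation [NeZero n] :
    Nonempty (ShiftGroup n ≃* ShiftPresentation n) := by
  obtain ⟨fn, hfn⟩ := exists_hom_vectors n
  obtain ⟨fg, hfg⟩ := exists_hom_rotations n
  have hone : fn.comp (cyclicShift n (Multiplicative.ofAdd 1)).toMonoidHom =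
      (MulAut.conj (fg (Multiplicative.ofAdd 1))).toMonoidHom.comp fn := by
    refine hom_ext_unitVector fun j => ?_
    simp only [MonoidHom.comp_apply, MulEquiv.toMonoidHom_eq_coe, MonoidHom.coe_coe,
      cyclicShift_unitVector, hfn, hfg, MulAut.conj_apply]
    rw [presY_mul_presX, mul_inv_cancel_right]
  have hpow : ∀ (k : ℕ) (v : Multiplicative (ZMod n → ℤ)),
      fn (cyclicShift n (Multiplicative.ofAdd 1 ^ k) v) =
        fg (Multiplicative.ofAdd 1 ^ k) * fn v * (fg (Multiplicative.ofAdd 1 ^ k))⁻¹ := by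
    intro k
    induction k with
    | zero => simp
    | succ k ih =>
      intro v
      have h := DFunLike.congr_fun hone (cyclicShift n (Multiplicative.ofAdd 1 ^ k) v)
      simp only [MonoidHom.comp_apply, MulEquiv.toMonoidHom_eq_coe, MonoidHom.coe_coe,
        MulAut.conj_apply, ih] at h
      rw [pow_succ', map_mul, map_mul, MulAut.mul_apply, h]
      group
  have hcompat : ∀ g, fn.comp (cyclicShift n g).toMonoidHom =
      (MulAut.conj (fg g)).toMonoidHom.comp fn := fun g => by
    refine MonoidHom.ext fun v => ?_
    rw [ofAdd_eq_pow n g]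
    exact hpow _ v
  let F : ShiftPresentation n →* ShiftGroup n := PresentedGroup.toGroup (lift_genImage_relator n)
  have hF : ∀ u, F (PresentedGroup.of u) = genImage n u := fun u => PresentedGroup.toGroup.of _
  refine ⟨MonoidHom.toMulEquiv (SemidirectProduct.lift fn fg hcompat) F ?_ ?_⟩
  · refine SemidirectProduct.hom_ext (hom_ext_unitVector fun j => ?_) ?_
    · simp only [MonoidHom.comp_apply, SemidirectProduct.lift_inl, hfn, hF, genImage,
        MonoidHom.id_apply]
    · refine MonoidHom.ext fun g => ?_
      rw [ofAdd_eq_pow n g]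
      simp only [MonoidHom.comp_apply, SemidirectProduct.lift_inr, map_pow, hfg, hF, genImage,
        MonoidHom.id_apply]
  · refine PresentedGroup.ext fun u => ?_
    cases u with
    | x j =>
      simp only [MonoidHom.comp_apply, hF, genImage, SemidirectProduct.lift_inl, hfn,
        MonoidHom.id_apply]
    | y =>
      simp only [MonoidHom.comp_apply, hF, genImage, SemidirectProduct.lift_inr, hfg,
        MonoidHom.id_apply]

end Presentation

end BlaschkeInvariants

/-! ### The invariants inside the semidirect product, and the three cases -/

namespace BlaschkeInvariants

open scoped Real

/-- A point arriving in arc `j` was in arc `j - m` after `g'`, so that is where `v'` is read. This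
is exactly multiplication in `ShiftGroup p`. -/
theorem IsShift.mul {p : ℕ} {B : ℂ → ℂ} {s : ℤ → ℝ} {φ : Circle → ℝ} {g g' : Function.End Circle}
    {v v' : ZMod p → ℤ} {m m' : ZMod p} (h : IsShift p B s φ g v m)
    (h' : IsShift p B s φ g' v' m') :
    IsShift p B s φ (g * g' : Function.End Circle) (fun j => v j + v' (j - m)) (m + m') := by
  intro ζ hζ
  obtain ⟨h1, h2, h3⟩ := h' ζ hζ
  obtain ⟨k1, k2, k3⟩ := h _ h1
  refine ⟨k1, ?_, ?_⟩
  · change arcIndex p s (g (g' ζ)) = _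
    rw [k2, h2]; ring
  · change φ (g (g' ζ)) = φ ζ + ((v (arcIndex p s (g (g' ζ))) +
      v' (arcIndex p s (g (g' ζ)) - m) : ℤ) : ℝ) * (2 * π)
    have e : arcIndex p s (g (g' ζ)) - m = arcIndex p s (g' ζ) := by rw [k2]; ring
    rw [e, k3, h3]
    push_cast; ring

theorem IsShift.one {p : ℕ} {B : ℂ → ℂ} {s : ℤ → ℝ} {φ : Circle → ℝ} :
    IsShift p B s φ (1 : Function.End Circle) 0 0 := by
  intro ζ hζ
  refine ⟨hζ, ?_, ?_⟩
  · change arcIndex p s ζ = _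
    rw [add_zero]
  · change φ ζ = _
    simp

/-- A non-empty interval that is invariant under a non-zero translation is the whole line. -/
theorem eq_zero_of_add_mem_iff {R : Set ℝ} (hR : R.OrdConnected) (hne : R.Nonempty)
    (huniv : R ≠ Set.univ) {c : ℝ} (h : ∀ x, x ∈ R ↔ x + c ∈ R) : c = 0 := by
  by_contra hc
  obtain ⟨x₀, hx₀⟩ := hne
  have hmul : ∀ n : ℤ, x₀ + n * c ∈ R := fun n => by
    induction n using Int.induction_on with
    | zero => simpa
    | succ n ih =>
      have := (h _).1 ih
      rwa [show x₀ + ((n : ℤ) + 1 : ℤ) * c = x₀ + (n : ℤ) * c + c by push_cast; ring]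
    | pred n ih =>
      refine (h _).2 ?_
      rwa [show x₀ + (-(n : ℤ) - 1 : ℤ) * c + c = x₀ + (-(n : ℤ) : ℤ) * c by push_cast; ring]
  refine huniv (Set.eq_univ_of_forall fun x => ?_)
  obtain ⟨k, hk⟩ := exists_int_lt ((x - x₀) / c)
  obtain ⟨l, hl⟩ := exists_int_gt ((x - x₀) / c)
  rcases lt_or_gt_of_ne hc with hneg | hpos
  · rw [lt_div_iff_of_neg hneg] at hk
    rw [div_lt_iff_of_neg hneg] at hl
    exact hR.out (hmul l) (hmul k) ⟨by linarith, by linarith⟩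
  · rw [lt_div_iff₀ hpos] at hk
    rw [div_lt_iff₀ hpos] at hl
    exact hR.out (hmul k) (hmul l) ⟨by linarith, by linarith⟩

/-- A set of residues modulo a prime that is invariant under a non-zero shift is trivial. -/
theorem eq_univ_of_add_mem {p : ℕ} [Fact p.Prime] {T : Set (ZMod p)} {m : ZMod p} (hm : m ≠ 0)
    (h : ∀ j ∈ T, j + m ∈ T) (hne : T.Nonempty) : T = Set.univ := by
  obtain ⟨j, hj⟩ := hne
  have hmul : ∀ n : ℕ, j + n * m ∈ T := fun n => by
    induction n with
    | zero => simpa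
    | succ n ih =>
      have := h _ ih
      rwa [show j + ((n + 1 : ℕ) : ZMod p) * m = j + n * m + m by push_cast; ring]
  refine Set.eq_univ_of_forall fun k => ?_
  have := hmul ((k - j) / m).val
  rwa [ZMod.natCast_zmod_val, div_mul_cancel₀ _ hm, add_sub_cancel] at this

namespace PhaseData

variable {p : ℕ} {B : ℂ → ℂ} {s : ℤ → ℝ} {φ : Circle → ℝ}

theorem isShift_unique (P : PhaseData p B s φ) {g : Circle → Circle} {v v' : ZMod p → ℤ}
    {m m' : ZMod p} (h : IsShift p B s φ g v m) (h' : IsShift p B s φ g v' m') :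
    v = v' ∧ m = m' := by
  have hm : m = m' := by
    obtain ⟨ζ, hζ, -⟩ := P.exists_mem_arc 0
    exact add_left_cancel ((h ζ hζ).2.1.symm.trans (h' ζ hζ).2.1)
  refine ⟨funext fun j => ?_, hm⟩
  obtain ⟨ζ, hζ, hj⟩ := P.exists_mem_arc (j - m)
  obtain ⟨-, h1, h2⟩ := h ζ hζ
  have h3 := (h' ζ hζ).2.2
  rw [hj, sub_add_cancel] at h1
  rw [h2, h1] at h3
  have h4 := mul_right_cancel₀ Real.two_pi_pos.ne' (add_left_cancel h3)
  exact_mod_cast h4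

/-- Arc and phase determine a regular point, and the regular angles are dense. -/
theorem isShift_injective (P : PhaseData p B s φ) {g g' : Circle → Circle} (hg : Continuous g)
    (hg' : Continuous g') {v : ZMod p → ℤ} {m : ZMod p} (h : IsShift p B s φ g v m)
    (h' : IsShift p B s φ g' v m) : g = g' := by
  have hd : Dense (Set.range s)ᶜ := Set.Countable.dense_compl ℝ (Set.countable_range s)
  have he : g ∘ Circle.exp = g' ∘ Circle.exp := by
    refine Continuous.ext_on hd (hg.comp Circle.exp.continuous) (hg'.comp Circle.exp.continuous)
      fun θ hθ => ?_
    have hζ : Circle.exp θ ∉ singularSet B := fun hc => hθ ((P.mem_singularSet θ).1 hc)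
    obtain ⟨h1, h2, h3⟩ := h _ hζ
    obtain ⟨k1, k2, k3⟩ := h' _ hζ
    exact P.phase_injective h1 k1 (h2.trans k2.symm) (h3.trans (by rw [h2, ← k2]; exact k3.symm))
  exact Circle.exp_surjective.injective_comp_right he

/-- The invariants form the group of the admissible phase shifts and rotations. -/
theorem exists_hom (P : PhaseData p B s φ) :
    ∃ Ψ : invariants B →* ShiftGroup p, Function.Injective Ψ ∧
      ∀ h : ShiftGroup p, h ∈ Set.range Ψ ↔
        IsCompatible p B s φ h.left.toAdd h.right.toAdd := by
  have hex : ∀ g : invariants B, ∃ h : ShiftGroup p,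
      IsShift p B s φ (g : Function.End Circle) h.left.toAdd h.right.toAdd ∧
        IsCompatible p B s φ h.left.toAdd h.right.toAdd := fun g => by
    obtain ⟨v, m, h⟩ := P.exists_isShift g.2
    exact ⟨⟨Multiplicative.ofAdd v, Multiplicative.ofAdd m⟩, h⟩
  choose Ψ hΨ hΨc using hex
  have huniq : ∀ (g : Function.End Circle) (h h' : ShiftGroup p),
      IsShift p B s φ g h.left.toAdd h.right.toAdd →
      IsShift p B s φ g h'.left.toAdd h'.right.toAdd → h = h' := fun g h h' k k' => by
    obtain ⟨h1, h2⟩ := P.isShift_unique k k'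
    exact SemidirectProduct.ext (Multiplicative.toAdd.injective h1)
      (Multiplicative.toAdd.injective h2)
  -- The homomorphism laws hold because an invariant has only one pair of shift and rotation.
  refine ⟨{ toFun := Ψ, map_one' := huniq 1 _ _ (hΨ 1) IsShift.one,
            map_mul' := fun g g' => huniq (g * g') _ _ (hΨ (g * g')) ((hΨ g).mul (hΨ g')) },
    fun g g' hgg => ?_, fun h => ⟨?_, fun hc => ?_⟩⟩
  · replace hgg : Ψ g = Ψ g' := hgg
    have h1 := hΨ g
    rw [hgg] at h1
    exact Subtype.ext (P.isShift_injective g.2.1 g'.2.1 h1 (hΨ g'))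
  · rintro ⟨g, rfl⟩
    exact hΨc g
  · obtain ⟨g, hg, hgs⟩ := P.exists_invariant hc
    exact ⟨⟨g, hg⟩, huniq g _ _ (hΨ ⟨g, hg⟩) hgs⟩

theorem eq_zero_of_phaseRange (P : PhaseData p B s φ) {j : ZMod p} {n : ℤ}
    (hj : phaseRange p B s φ j ≠ Set.univ)
    (h : ∀ x, x ∈ phaseRange p B s φ j ↔ x + n * (2 * π) ∈ phaseRange p B s φ j) : n = 0 := by
  have := eq_zero_of_add_mem_iff (P.ordConnected_phaseRange j) (P.phaseRange_nonempty j) hj h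
  simpa [Real.pi_ne_zero] using this

end PhaseData

theorem IsCompatible.eq_univ {p : ℕ} {B : ℂ → ℂ} {s : ℤ → ℝ} {φ : Circle → ℝ}
    {v : ZMod p → ℤ} {m : ZMod p} (h : IsCompatible p B s φ v m) {j : ZMod p}
    (hj : phaseRange p B s φ j = Set.univ) : phaseRange p B s φ (j + m) = Set.univ := by
  refine Set.eq_univ_of_forall fun x => ?_
  have := (h j (x - v (j + m) * (2 * π))).1 (hj ▸ Set.mem_univ _)
  rwa [sub_add_cancel] at this

namespace PhaseData

variable {p : ℕ} {B : ℂ → ℂ} {s : ℤ → ℝ} {φ : Circle → ℝ}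

/-- Two such shifts translate the same range onto `R_j`, so `R_j` is invariant under their
difference, which must vanish. -/
theorem isCompatible_unique (P : PhaseData p B s φ)
    (hT : ∀ j, phaseRange p B s φ j ≠ Set.univ) {v v' : ZMod p → ℤ} {m : ZMod p}
    (h : IsCompatible p B s φ v m) (h' : IsCompatible p B s φ v' m) : v = v' := by
  funext j
  have h0 : v' j - v j = 0 := by
    refine P.eq_zero_of_phaseRange (hT j) fun x => ?_
    have h1 := h (j - m) (x - v j * (2 * π))
    have h2 := h' (j - m) (x - v j * (2 * π))
    rw [sub_add_cancel] at h1 h2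
    rw [sub_add_cancel] at h1
    rw [← h1, h2]
    push_cast
    rw [show x - v j * (2 * π) + v' j * (2 * π) = x + (v' j - v j : ℝ) * (2 * π) by ring]
  omega

theorem isCompatible_zero_iff (P : PhaseData p B s φ) {v : ZMod p → ℤ} :
    IsCompatible p B s φ v 0 ↔ ∀ j, phaseRange p B s φ j ≠ Set.univ → v j = 0 := by
  constructor
  · intro h j hj
    refine P.eq_zero_of_phaseRange hj fun x => ?_
    simpa only [add_zero] using h j x
  · intro h j x
    rw [add_zero]
    by_cases hj : phaseRange p B s φ j = Set.univ
    · simp [hj]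
    · simp [h j hj]

/-- If no arc is of type 2, an invariant is determined by the rotation of the arcs. -/
theorem classify_zero [Fact p.Prime] (P : PhaseData p B s φ)
    (hT : ∀ j, phaseRange p B s φ j ≠ Set.univ) :
    invariants B = ⊥ ∨ Nonempty (invariants B ≃* Multiplicative (ZMod p)) := by
  obtain ⟨Ψ, hinj, hrange⟩ := P.exists_hom
  set f : invariants B →* Multiplicative (ZMod p) := SemidirectProduct.rightHom.comp Ψ with hf
  have hf' : ∀ g, f g = (Ψ g).right := fun g => rfl
  have hfinj : Function.Injective f := fun g g' hgg => by
    rw [hf', hf'] at hgg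
    have h1 := (hrange _).1 ⟨g, rfl⟩
    have h2 := (hrange _).1 ⟨g', rfl⟩
    rw [← hgg] at h2
    exact hinj (SemidirectProduct.ext
      (Multiplicative.toAdd.injective (P.isCompatible_unique hT h1 h2)) hgg)
  by_cases h : ∀ g, f g = 1
  · left
    refine (Submonoid.eq_bot_iff_forall _).2 fun g hg => ?_
    have : (⟨g, hg⟩ : invariants B) = 1 := hfinj (by rw [h, map_one])
    exact congrArg Subtype.val this
  · right
    push Not at h
    obtain ⟨g, hg⟩ := h
    have hg' : (f g).toAdd ≠ 0 := fun e => hg (Multiplicative.toAdd.injective e)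
    -- A non-zero residue modulo a prime generates, and natural exponents suffice, so no inverses of
    -- invariants are needed.
    refine ⟨MulEquiv.ofBijective f ⟨hfinj, fun k => ⟨g ^ (k.toAdd / (f g).toAdd).val, ?_⟩⟩⟩
    rw [map_pow]
    apply Multiplicative.toAdd.injective
    rw [toAdd_pow, nsmul_eq_mul, ZMod.natCast_zmod_val, div_mul_cancel₀ _ hg']

/-- If some, but not all, of the arcs are of type 2, all arcs are fixed and the phases on the arcs
of type 2 can be shifted independently. -/
theorem classify_intermediate [Fact p.Prime] (P : PhaseData p B s φ)
    {T : Set (ZMod p)} (hT : T = {j | phaseRange p B s φ j = Set.univ})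
    (hne : T.Nonempty) (huniv : T ≠ Set.univ) :
    Nonempty (invariants B ≃* Multiplicative (Fin T.ncard → ℤ)) := by
  obtain ⟨Ψ, hinj, hrange⟩ := P.exists_hom
  have hmemT : ∀ j, j ∈ T ↔ phaseRange p B s φ j = Set.univ := fun j => by rw [hT]; rfl
  -- A non-trivial rotation would spread the type 2 arcs over all residues, against `huniv`.
  have hright : ∀ g, (Ψ g).right = 1 := fun g => by
    by_contra hg
    have hc := (hrange _).1 ⟨g, rfl⟩
    refine huniv (eq_univ_of_add_mem (m := (Ψ g).right.toAdd)
      (fun e => hg (Multiplicative.toAdd.injective e)) (fun j hj => ?_) hne)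
    exact (hmemT _).2 (hc.eq_univ ((hmemT _).1 hj))
  have hzero : ∀ g, ∀ j ∉ T, (Ψ g).left.toAdd j = 0 := fun g j hj => by
    have hc := (hrange _).1 ⟨g, rfl⟩
    rw [hright] at hc
    exact P.isCompatible_zero_iff.1 hc j fun e => hj ((hmemT j).2 e)
  let e : T ≃ Fin T.ncard := Finite.equivFinOfCardEq (Nat.card_coe_set_eq T)
  let f : invariants B →* Multiplicative (Fin T.ncard → ℤ) :=
    { toFun := fun g => Multiplicative.ofAdd fun k => (Ψ g).left.toAdd (e.symm k)
      map_one' := by rw [map_one]; rfl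
      map_mul' := fun g g' => by
        rw [map_mul, SemidirectProduct.mul_left, hright g, map_one]
        rfl }
  have hf : ∀ g k, (f g).toAdd k = (Ψ g).left.toAdd (e.symm k) := fun g k => rfl
  refine ⟨MulEquiv.ofBijective f ⟨fun g g' hgg => ?_, fun w => ?_⟩⟩
  · refine hinj (SemidirectProduct.ext (Multiplicative.toAdd.injective (funext fun j => ?_))
      ((hright g).trans (hright g').symm))
    by_cases hj : j ∈ T
    · have h1 := hf g (e ⟨j, hj⟩)
      have h2 := hf g' (e ⟨j, hj⟩)
      rw [Equiv.symm_apply_apply] at h1 h2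
      rw [← h1, ← h2, hgg]
    · rw [hzero g j hj, hzero g' j hj]
  · classical
    set v : ZMod p → ℤ := fun j => if hj : j ∈ T then w.toAdd (e ⟨j, hj⟩) else 0 with hv
    have hc : IsCompatible p B s φ v 0 := P.isCompatible_zero_iff.2 fun j hj => by
      have : j ∉ T := fun h => hj ((hmemT j).1 h)
      simp [hv, this]
    obtain ⟨g, hg⟩ := (hrange ⟨Multiplicative.ofAdd v, Multiplicative.ofAdd 0⟩).2 hc
    refine ⟨g, Multiplicative.toAdd.injective (funext fun k => ?_)⟩
    rw [hf, hg]
    simp [hv]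

/-- If all arcs are of type 2, every rotation of the arcs and every shift is admissible. -/
theorem classify_all (P : PhaseData p B s φ) (hT : ∀ j, phaseRange p B s φ j = Set.univ) :
    Nonempty (invariants B ≃* ShiftGroup p) := by
  obtain ⟨Ψ, hinj, hrange⟩ := P.exists_hom
  exact ⟨MulEquiv.ofBijective Ψ ⟨hinj, fun h => (hrange h).2 fun j x => by simp [hT]⟩⟩

end PhaseData

end BlaschkeInvariants

open BlaschkeInvariants in
theorem mainTheorem2 (p : ℕ) (hp : p.Prime) (B : ℂ → ℂ) (hB : IsBlaschkeProduct B)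
    (hσ : (singularSet B).ncard = p) :
    (numTypeTwo B = 0 ∧
      (invariants B = ⊥ ∨ Nonempty (invariants B ≃* Multiplicative (ZMod p)))) ∨
    (∃ r : ℕ, numTypeTwo B = r ∧ 1 ≤ r ∧ r < p ∧
      Nonempty (invariants B ≃* Multiplicative (Fin r → ℤ))) ∨
    (numTypeTwo B = p ∧
      Nonempty (invariants B ≃*
        Multiplicative (ZMod p → ℤ) ⋊[cyclicShift p] Multiplicative (ZMod p)) ∧
      Nonempty (invariants B ≃* ShiftPresentation p)) := by
  have : Fact p.Prime := ⟨hp⟩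
  obtain ⟨s, φ, P⟩ := hB.exists_phaseData hp.pos hσ
  set T : Set (ZMod p) := {j | phaseRange p B s φ j = Set.univ} with hT
  have hnum : numTypeTwo B = T.ncard := P.numTypeTwo_eq
  rcases T.eq_empty_or_nonempty with hempty | hne
  · left
    refine ⟨by rw [hnum, hempty, Set.ncard_empty], P.classify_zero fun j hj => ?_⟩
    have : j ∈ T := hj
    rw [hempty] at this
    exact this
  · right
    by_cases huniv : T = Set.univ
    · right
      obtain ⟨e⟩ := P.classify_all fun j => by
        have : j ∈ T := huniv ▸ Set.mem_univ j
        exact this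
      obtain ⟨e'⟩ := nonempty_equiv_presentation p
      exact ⟨by rw [hnum, huniv, Set.ncard_univ, Nat.card_zmod], ⟨e⟩, ⟨e.trans e'⟩⟩
    · left
      refine ⟨T.ncard, hnum, (Set.ncard_pos T.toFinite).2 hne, ?_,
        P.classify_intermediate hT hne huniv⟩
      have := Set.ncard_lt_ncard (Set.ssubset_univ_iff.2 huniv) (Set.toFinite _)
      rwa [Set.ncard_univ, Nat.card_zmod] at this
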